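/- Let $\Sigma$ be a fixed finite alphabet, and let the suffix tree over a string $T=t_0\cdots t_{N-1}\in\Sigma^N$ be constructed online; after iteration $i$ it is the suffix tree $ST_i$ of $t_0\cdots t_{i-1}$ (without end marker), augmented by an auxiliary edge $\top$, labelled by the empty string, that enters the root. An edge is identified with the shortest string it represents, which is said to mark it (so when an edge is split, the upper part remains the same edge); $\top$ is marked by the empty string. An edge is internal if its endpoint is not a leaf. For an internal edge $e\ne\top$, let $\mathrm{suf}(e)$ be the edge marked by $A$, where $aA$ (with $a\in\Sigma$) is the shortest string represented by $e$ such that $A$ marks an edge, $A$ empty being admitted only if the endpoint of $e$ corresponds to a string of length one. The link tree $LT_i$ has the internal edges of $ST_i$ as its nodes, $\top$ as its root and $\mathrm{suf}(e)$ as the parent of $e$; every node counts as an ancestor and a descendant of itself. In each iteration $i$ at most one edge $u_i$ is pos-updated, namely an internal edge $u_i\neq\top$ of $ST_i$ whose endpoint corresponds to a suffix of $t_0\cdots t_{i-1}$ that also occurs earlier (for instance always the deepest such edge). Each internal edge $e$ carries a value $\mathrm{repr}(e)$, which is an internal edge, initially $\top$ (meaning "not set"). Property 1 says: for every node $g$ of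 the link tree, if $e$ is the most recently pos-updated node in the subtree rooted at $g$, then $\mathrm{repr}(a)=e$ for some ancestor $a$ of $g$. Time is the number of executed elementary steps of a fixed program with finitely many registers for edges and numbers, which can read and write $\mathrm{repr}$ and further fields of the edges, follow suffix links in both directions, and ask for the lowest common ancestor of two nodes of the link tree and for the child of a node towards a given descendant, at unit cost each. The program is executed once in each iteration $i$, on the current tree $ST_i$ and given $u_i$ (or $\top$ if nothing is pos-updated); constructing the tree and locating $u_i$ are not counted. Then, with constants that depend only on $\Sigma$: 1. The values $\mathrm{repr}$ can be maintained so that Property 1 holds after every iteration, in total time $O(N\log N)$: there are a program and a constant $C$ such that for every $T$ and every such sequence of pos-updated edges the program terminates in each iteration, Property 1 holds after each iteration, and, if $N\ge 2$, the total time is at most $C N\log N$. 2. Invoking $\mathrm{reprupd}(u_i,\top)$ in each iteration $i$ in which an edge is pos-updated terminates and takes total time $O(N\log N)$, for all recursive calls together, where $\mathrm{reprupd}(e,r)$ is the following procedure: let $f$ be the old value of $\mathrm{repr}(r)$, and set $\mathrm{repr}(r)$ to $e$; if $f=\top$, terminate; let $g$ be the lowest common ancestor of $e$ and $f$ in the link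 tree; if $g=f$, terminate; let $h$ be the child of $g$ that is an ancestor of $f$, and invoke $\mathrm{reprupd}(f,h)$. -/

import Mathlib

namespace SufTree

/-! ### The suffix tree of a string

The suffix tree of `T` is described through the strings that correspond to its points.  An edge is
named by the string that marks it (the shortest nonempty string it represents); the auxiliary edge
above the root is marked by the empty string.  When an edge is split by a new node, the upper part
keeps its name, and the lower part is a new edge. -/

/-- The name of an edge: the string that marks it. -/
abbrev Edge (σ : Type*) := List σ

/-- The auxiliary edge `⊤`, whose endpoint is the root. -/
def topEdge {σ : Type*} : Edge σ := []

/-- `V` corresponds to the root or to an inner (i.e. branching) node of the suffix tree of `T`. -/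
def IsNode {σ : Type*} (T V : List σ) : Prop :=
  V = [] ∨ ∃ a b, a ≠ b ∧ V ++ [a] <:+: T ∧ V ++ [b] <:+: T

/-- `A` marks an edge of the suffix tree of `T`: either the edge `⊤`, or the edge that leaves the
node `U` with first symbol `c`. -/
def Marks {σ : Type*} (T A : List σ) : Prop :=
  A = [] ∨ ∃ U c, IsNode T U ∧ A = U ++ [c] ∧ A <:+: T

/-- The edge `e` is internal, and its endpoint is the (non-leaf) node `V`: the nearest node at or
below the point `e`. -/
def HasEndpoint {σ : Type*} (T : List σ) (e : Edge σ) (V : List σ) : Prop :=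
  Marks T e ∧ IsNode T V ∧ e <+: V ∧ ∀ W, IsNode T W → e <+: W → V.length ≤ W.length

/-- `e` is an internal edge: its endpoint is not a leaf. -/
def IsInternal {σ : Type*} (T : List σ) (e : Edge σ) : Prop :=
  ∃ V, HasEndpoint T e V

/-- `A` marks an edge, and the internal edge `e` represents `a A` for some symbol `a`.
The edge `⊤`, i.e. `A` empty, is admitted only if the endpoint of `e` has length one. -/
def SufCandidate {σ : Type*} (T : List σ) (e : Edge σ) (A : List σ) : Prop :=
  ∃ a V, HasEndpoint T e V ∧ e <+: a :: A ∧ a :: A <+: V ∧ Marks T A ∧ (A = [] → V.length = 1)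

/-- The edge-oriented suffix link `suf e = f`: the string that marks `f` is the `A` for which `a A`
is the shortest string represented by `e` such that `A` marks an edge. -/
def IsSuf {σ : Type*} (T : List σ) (e f : Edge σ) : Prop :=
  SufCandidate T e f ∧ ∀ B, SufCandidate T e B → f.length ≤ B.length

/-! ### The link tree

Its nodes are the internal edges, its root is `⊤`, and the parent of `e` is `suf e`. -/

/-- `a` is an ancestor of `e` in the link tree (every node is an ancestor of itself). -/
def IsAncestor {σ : Type*} (T : List σ) (a e : Edge σ) : Prop :=
  Relation.ReflTransGen (IsSuf T) e a

/-- `g` is the lowest common ancestor of `e` and `f`. -/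
def IsLCA {σ : Type*} (T : List σ) (e f g : Edge σ) : Prop :=
  IsAncestor T g e ∧ IsAncestor T g f ∧
    ∀ c, IsAncestor T c e → IsAncestor T c f → IsAncestor T c g

/-! ### Position updates -/

/-- `S` is an active suffix: a suffix of `T` that also appears elsewhere (earlier) in `T`. -/
def IsActiveSuffix {σ : Type*} (T S : List σ) : Prop :=
  S <:+ T ∧ ∃ X Y, T = X ++ S ++ Y ∧ Y ≠ []

/-- `e ≠ ⊤` is an internal edge whose endpoint corresponds to an active suffix.  The update edge is
chosen among these edges. -/
def IsPosUpdatable {σ : Type*} (T : List σ) (e : Edge σ) : Prop :=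
  e ≠ topEdge ∧ ∃ V, HasEndpoint T e V ∧ IsActiveSuffix T V

/-- A schedule of position updates during the construction over `T`: in iteration `i`, after which
the tree is that of the first `i` symbols, the edge that is pos-updated is `u i`, if any. -/
def IsSchedule {σ : Type*} (T : List σ) (u : ℕ → Option (Edge σ)) : Prop :=
  ∀ i, 1 ≤ i → i ≤ T.length → ∀ e, u i = some e → IsPosUpdatable (T.take i) e

/-- After `i` iterations, `e` is the most recently pos-updated node in the subtree, rooted at `g`,
of the link tree of `T`. -/
def IsMostRecent {σ : Type*} (T : List σ) (u : ℕ → Option (Edge σ)) (i : ℕ) (g e : Edge σ) :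
    Prop :=
  IsAncestor T g e ∧ ∃ j, 1 ≤ j ∧ j ≤ i ∧ u j = some e ∧
    ∀ j', j < j' → j' ≤ i → ∀ e', u j' = some e' → ¬ IsAncestor T g e'

/-- The maintained property of the `repr` values, after `i` iterations: for every node `g` of the
link tree, if `e` is the most recently pos-updated node in the subtree rooted at `g`, then
`repr a = e` for some ancestor `a` of `g`. -/
def ReprProperty {σ : Type*} (T : List σ) (u : ℕ → Option (Edge σ)) (i : ℕ)
    (repr : Edge σ → Edge σ) : Prop :=
  ∀ g e, IsInternal T g → IsMostRecent T u i g e → ∃ a, IsAncestor T a g ∧ repr a = e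

/-! ### A machine with a step count

A program is a fixed finite text that operates on registers for edges and for numbers, and on the
records of the edges.  A record holds the value `repr` and further fields for edges and for numbers.
The suffix links in both directions, and the lowest common ancestors in the link tree, are provided
by the suffix tree.  Edge registers can be copied, compared and dereferenced, but the string behind
an edge is not accessible. -/

/-- The elementary instructions; `x y z` are edge registers, `p q` number registers, `k` is the
index of a field. -/
inductive Instr (σ : Type*) where
  /-- `x := ⊤` -/
  | top (x : ℕ)
  /-- `x := y` -/
  | move (x y : ℕ)
  /-- `x := repr y` -/
  | getRepr (x y : ℕ)
  /-- `repr y := x` -/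
  | setRepr (y x : ℕ)
  /-- `x := suf y` -/
  | suf (x y : ℕ)
  /-- `x := rsuf y a`, the child of `y` in the link tree for the symbol `a`, or `⊤` if none exists -/
  | rsuf (x y : ℕ) (a : σ)
  /-- `x :=` the lowest common ancestor of `y` and `z` in the link tree -/
  | lca (x y z : ℕ)
  /-- `x :=` the child of `y` in the link tree that is an ancestor of `z` -/
  | toward (x y z : ℕ)
  /-- `x := field k of y` -/
  | getField (x k y : ℕ)
  /-- `field k of y := x` -/
  | setField (k y x : ℕ)
  /-- `p := 0` -/
  | zero (p : ℕ)
  /-- `p := p + 1` -/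
  | succ (p : ℕ)
  /-- `p := q` -/
  | moveNum (p q : ℕ)
  /-- `p := number field k of y` -/
  | getNum (p k y : ℕ)
  /-- `number field k of y := p` -/
  | setNum (k y p : ℕ)

/-- The tests. -/
inductive Test where
  /-- the edge registers `x` and `y` are equal -/
  | eq (x y : ℕ)
  /-- the edge register `x` holds `⊤` -/
  | isTop (x : ℕ)
  /-- the number in register `p` is less than that in `q` -/
  | lt (p q : ℕ)

/-- Programs. -/
inductive Prog (σ : Type*) where
  | skip
  | instr (c : Instr σ)
  | seq (P Q : Prog σ)
  | ite (b : Test) (P Q : Prog σ)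
  | whileNot (b : Test) (P : Prog σ)

/-- Machine configurations. -/
structure Config (σ : Type*) where
  reg : ℕ → Edge σ
  num : ℕ → ℕ
  repr : Edge σ → Edge σ
  field : ℕ → Edge σ → Edge σ
  numField : ℕ → Edge σ → ℕ

/-- Initially all edge values are `⊤` (which stands for `not set`), and all numbers are `0`. -/
def Config.init (σ : Type*) : Config σ where
  reg := fun _ => topEdge
  num := fun _ => 0
  repr := fun _ => topEdge
  field := fun _ _ => topEdge
  numField := fun _ _ => 0

/-- Put `e` into the edge register `x`. -/
def Config.setReg {σ : Type*} (s : Config σ) (x : ℕ) (e : Edge σ) : Config σ :=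
  { s with reg := Function.update s.reg x e }

/-- Put `n` into the number register `p`. -/
def Config.setNumReg {σ : Type*} (s : Config σ) (p n : ℕ) : Config σ :=
  { s with num := Function.update s.num p n }

/-- The truth of a test in a configuration. -/
def Test.Holds {σ : Type*} (s : Config σ) : Test → Prop
  | .eq x y => s.reg x = s.reg y
  | .isTop x => s.reg x = topEdge
  | .lt p q => s.num p < s.num q

/-- The effect of an instruction while the tree is the suffix tree of `T`. -/
inductive Instr.Exec {σ : Type*} [DecidableEq σ] (T : List σ) :
    Instr σ → Config σ → Config σ → Prop
  | top (s x) : Exec T (.top x) s (s.setReg x topEdge)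
  | move (s x y) : Exec T (.move x y) s (s.setReg x (s.reg y))
  | getRepr (s x y) : Exec T (.getRepr x y) s (s.setReg x (s.repr (s.reg y)))
  | setRepr (s y x) : Exec T (.setRepr y x) s
      { s with repr := Function.update s.repr (s.reg y) (s.reg x) }
  | suf (s x y f) : IsSuf T (s.reg y) f → Exec T (.suf x y) s (s.setReg x f)
  | rsuf (s x y a e) : IsSuf T e (s.reg y) → e.head? = some a →
      Exec T (.rsuf x y a) s (s.setReg x e)
  | rsufNone (s x y a) : (∀ e, IsSuf T e (s.reg y) → e.head? ≠ some a) →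
      Exec T (.rsuf x y a) s (s.setReg x topEdge)
  | lca (s x y z g) : IsLCA T (s.reg y) (s.reg z) g → Exec T (.lca x y z) s (s.setReg x g)
  | toward (s x y z h) : IsSuf T h (s.reg y) → IsAncestor T h (s.reg z) →
      Exec T (.toward x y z) s (s.setReg x h)
  | getField (s x k y) : Exec T (.getField x k y) s (s.setReg x (s.field k (s.reg y)))
  | setField (s k y x) : Exec T (.setField k y x) s
      { s with field := Function.update s.field k
                (Function.update (s.field k) (s.reg y) (s.reg x)) }
  | zero (s p) : Exec T (.zero p) s (s.setNumReg p 0)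
  | succ (s p) : Exec T (.succ p) s (s.setNumReg p (s.num p + 1))
  | moveNum (s p q) : Exec T (.moveNum p q) s (s.setNumReg p (s.num q))
  | getNum (s p k y) : Exec T (.getNum p k y) s (s.setNumReg p (s.numField k (s.reg y)))
  | setNum (s k y p) : Exec T (.setNum k y p) s
      { s with numField := Function.update s.numField k
                (Function.update (s.numField k) (s.reg y) (s.num p)) }

/-- `Exec T P s s' n`: while the tree is the suffix tree of `T`, the program `P`, started in `s`,
terminates in `s'` after `n` steps.  Every instruction and every test takes one step. -/
inductive Prog.Exec {σ : Type*} [DecidableEq σ] (T : List σ) :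
    Prog σ → Config σ → Config σ → ℕ → Prop
  | skip (s) : Exec T .skip s s 1
  | instr {c s s'} : Instr.Exec T c s s' → Exec T (.instr c) s s' 1
  | seq {P Q s₁ s₂ s₃ m n} : Exec T P s₁ s₂ m → Exec T Q s₂ s₃ n →
      Exec T (.seq P Q) s₁ s₃ (m + n)
  | iteTrue {b P Q s s' n} : Test.Holds s b → Exec T P s s' n → Exec T (.ite b P Q) s s' (n + 1)
  | iteFalse {b P Q s s' n} : ¬ Test.Holds s b → Exec T Q s s' n →
      Exec T (.ite b P Q) s s' (n + 1)
  | whileDone {b P s} : Test.Holds s b → Exec T (.whileNot b P) s s 1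
  | whileStep {b P s₁ s₂ s₃ m n} : ¬ Test.Holds s₁ b → Exec T P s₁ s₂ m →
      Exec T (.whileNot b P) s₂ s₃ n → Exec T (.whileNot b P) s₁ s₃ (m + n + 1)

/-- A run of the program `P` during the construction of the suffix tree over `T`, with the position
updates `u`.  In iteration `i + 1`, `P` is executed on the suffix tree of the first `i + 1` symbols,
with the pos-updated edge (or `⊤` if there is none) in register `0`; this takes `n i` steps and
leads from the configuration `S i` to `S (i + 1)`. -/
def IsRun {σ : Type*} [DecidableEq σ] (P : Prog σ) (T : List σ) (u : ℕ → Option (Edge σ))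
    (S : ℕ → Config σ) (n : ℕ → ℕ) : Prop :=
  S 0 = Config.init σ ∧ ∀ i < T.length,
    Prog.Exec (T.take (i + 1)) P ((S i).setReg 0 ((u (i + 1)).getD topEdge)) (S (i + 1)) (n i)

/-! ### The procedure `reprupd` -/

/-- One call `reprupd(e, r)`, with `e` in register `0` and `r` in register `1`:
let `f` be the old value of `repr r`, and set `repr r := e`; terminate if `f = ⊤`; let `g` be the
lowest common ancestor of `e` and `f`; terminate if `g = f`; let `h` be the child of `g` that is an
ancestor of `f`, and continue with the call `reprupd(f, h)`.
Termination is signalled by `⊤` in register `4`. -/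
def reprupdCall (σ : Type*) : Prog σ :=
  .seq (.instr (.getRepr 2 1)) <|
  .seq (.instr (.setRepr 1 0)) <|
  .ite (.isTop 2) (.instr (.top 4)) <|
  .seq (.instr (.lca 3 0 2)) <|
  .ite (.eq 3 2) (.instr (.top 4)) <|
  .seq (.instr (.toward 1 3 2)) (.instr (.move 0 2))

/-- `reprupd(e, ⊤)`, where `e` is the pos-updated edge; nothing is done if there is none. -/
def reprupd (σ : Type*) : Prog σ :=
  .ite (.isTop 0) .skip <|
  .seq (.instr (.top 1)) <|
  .seq (.instr (.move 4 0)) <|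
  .whileNot (.isTop 4) (reprupdCall σ)

end SufTree

/-! For an internal edge marked by at least two symbols the parent in the link tree is its tail
(`isSuf_cons_cons`), whatever the text. Among such long edges ancestors are therefore suffixes
(`IsInternal.isAncestor_iff`), and a growing text only adds nodes. Only the one-symbol edges, at
most |Σ| many, can change their parents: `[c]` hangs below ⊤ once it is a node, and before that
below the only symbol that follows `c`. Their treatment costs a constant per iteration. For long
edges both parts use amortization over a fixed set `E`, the internal edges of the final tree, at
most N + 1 in number (`card_edges_le`); the weight of `v` is the number of members of `E` with
suffix `v`, so potentials do not change when the tree grows.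

Part 1 uses a program of its own, `maintain`. Its invariant `Covers` says that a long edge either
stores its most recent update or shares it with its parent. An update `e` is entered as in the
access operation of link-cut trees: if `r` stores `f` and the paths to `e` and `f` part at `g`, then
`r` receives `e`, the child of `g` towards `f` receives `f`, and the search goes on at the child `k`
of `g` towards `e`. If `k` carries more than half of the weight of `g`, then `g` becomes guided;
otherwise the weight halves and at most one guided edge is lost. Hence `numUnguided` plus twice the
logarithm of the weight pays for every round (`numUnguided_round`). The values of the one-symbol
edges are rewritten in every iteration, from a list of the last symbols of the updates ordered by
recency.

Part 2 uses the sum of log slack(r, repr r) over the long edges `r`, where the slack is the weight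
of `r` minus the largest weight below `r` off the path to repr r. An inequality between arithmetic
and geometric means (`slack_mul_le`) shows that each recursive call is paid by this potential and by
the decrease of log weight. At one-symbol edges, whose values may have been displaced by a change of
parents, a measure bounded in terms of |Σ| decreases (`reprupd_loop`). -/

namespace SufTree

/-! ### Structure of the link tree. -/

variable {σ : Type*}

/-! ### Nodes and internal edges -/

/-- The occurrences of `V` before two different symbols end with occurrences of `W` before the same
symbols. All facts about suffix links rest on this closure. -/
theorem IsNode.of_suffix {T V W : List σ} (h : IsNode T V) (hW : W <:+ V) : IsNode T W := by
  rcases h with rfl | ⟨a, b, hab, ha, hb⟩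
  · left; simpa using hW
  · obtain ⟨X, rfl⟩ := hW
    refine Or.inr ⟨a, b, hab, ?_, ?_⟩
    · exact List.IsInfix.trans (List.IsSuffix.isInfix ⟨X, by simp⟩) ha
    · exact List.IsInfix.trans (List.IsSuffix.isInfix ⟨X, by simp⟩) hb

theorem IsNode.mono {T T' V : List σ} (h : IsNode T V) (hT : T <:+: T') : IsNode T' V := by
  rcases h with rfl | ⟨a, b, hab, ha, hb⟩
  · exact Or.inl rfl
  · exact Or.inr ⟨a, b, hab, ha.trans hT, hb.trans hT⟩

theorem IsNode.isInfix {T V : List σ} (h : IsNode T V) : V <:+: T := by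
  rcases h with rfl | ⟨a, b, -, ha, -⟩
  · exact List.nil_infix
  · exact (List.prefix_append V [a]).isInfix.trans ha

theorem isNode_nil (T : List σ) : IsNode T [] := Or.inl rfl

/-- A shortest node extending `e` is an endpoint, so any node below `e` suffices. In this form
internality is monotone in the text. -/
theorem isInternal_iff {T e : List σ} :
    IsInternal T e ↔ Marks T e ∧ ∃ W, IsNode T W ∧ e <+: W := by
  constructor
  · rintro ⟨V, hm, hV, hp, -⟩
    exact ⟨hm, V, hV, hp⟩
  · rintro ⟨hm, W, hW, hp⟩
    classical
    have hex : ∃ n, ∃ V, IsNode T V ∧ e <+: V ∧ V.length = n := ⟨_, W, hW, hp, rfl⟩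
    obtain ⟨V, hV, hVp, hVl⟩ := Nat.find_spec hex
    exact ⟨V, hm, hV, hVp, fun W' hW' hp' => hVl ▸ Nat.find_min' hex ⟨W', hW', hp', rfl⟩⟩

theorem Marks.mono {T T' A : List σ} (h : Marks T A) (hT : T <:+: T') : Marks T' A := by
  rcases h with rfl | ⟨U, c, hU, rfl, hA⟩
  · exact Or.inl rfl
  · exact Or.inr ⟨U, c, hU.mono hT, rfl, hA.trans hT⟩

theorem IsInternal.mono {T T' e : List σ} (h : IsInternal T e) (hT : T <:+: T') :
    IsInternal T' e := by
  obtain ⟨hm, W, hW, hp⟩ := isInternal_iff.1 h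
  exact isInternal_iff.2 ⟨hm.mono hT, W, hW.mono hT, hp⟩

theorem isInternal_nil (T : List σ) : IsInternal T [] :=
  isInternal_iff.2 ⟨Or.inl rfl, [], isNode_nil T, List.prefix_rfl⟩

theorem IsInternal.isInfix {T e : List σ} (h : IsInternal T e) : e <:+: T := by
  obtain ⟨-, W, hW, hp⟩ := isInternal_iff.1 h
  exact hp.isInfix.trans hW.isInfix

theorem Marks.tail {T e : List σ} (h : Marks T e) : Marks T e.tail := by
  rcases h with rfl | ⟨U, c, hU, rfl, hA⟩
  · exact Or.inl rfl
  · cases U with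
    | nil => exact Or.inl rfl
    | cons a U =>
      exact Or.inr ⟨U, c, hU.of_suffix (List.suffix_cons a U), rfl,
        (List.tail_suffix _).isInfix.trans hA⟩

theorem IsInternal.tail {T e : List σ} (h : IsInternal T e) : IsInternal T e.tail := by
  obtain ⟨hm, W, hW, hp⟩ := isInternal_iff.1 h
  refine isInternal_iff.2 ⟨hm.tail, ?_⟩
  cases e with
  | nil => exact ⟨[], isNode_nil T, List.prefix_rfl⟩
  | cons a e =>
    obtain ⟨X, rfl⟩ := hp
    exact ⟨e ++ X, hW.of_suffix (List.suffix_cons a _), List.prefix_append e X⟩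

theorem IsInternal.of_suffix {T e f : List σ} (h : IsInternal T e) (hf : f <:+ e) :
    IsInternal T f := by
  induction e with
  | nil => simpa using (List.suffix_nil.1 hf) ▸ h
  | cons a e ih =>
    rcases List.suffix_cons_iff.1 hf with rfl | hf
    · exact h
    · exact ih h.tail hf

theorem IsNode.isInfix_of_not {T W : List σ} {c : σ} (hc : ¬ IsNode T [c]) (hW : IsNode T W)
    (h : [c] <+: W) : ∃ d W', W = c :: d :: W' ∧ [c, d] <:+: T := by
  obtain ⟨X, rfl⟩ := h
  cases X with
  | nil => exact absurd hW hc
  | cons d X =>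
    refine ⟨d, X, rfl, ?_⟩
    exact List.IsInfix.trans (List.IsPrefix.isInfix ⟨X, rfl⟩) hW.isInfix

theorem follow_unique {T : List σ} {c d d' : σ} (hc : ¬ IsNode T [c]) (h : [c, d] <:+: T)
    (h' : [c, d'] <:+: T) : d = d' := by
  by_contra hne
  exact hc (Or.inr ⟨d, d', hne, h, h'⟩)

/-! ### Suffix links -/

theorem HasEndpoint.isInternal {T e V : List σ} (h : HasEndpoint T e V) : IsInternal T e := ⟨V, h⟩

theorem IsSuf.isInternal {T e f : List σ} (h : IsSuf T e f) : IsInternal T e := by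
  obtain ⟨⟨a, V, hV, -⟩, -⟩ := h
  exact ⟨V, hV⟩

theorem IsSuf.ne_nil {T e f : List σ} (h : IsSuf T e f) : e ≠ [] := by
  rintro rfl
  obtain ⟨⟨a, V, hV, -, hp, -⟩, -⟩ := h
  have := hV.2.2.2 [] (isNode_nil T) List.prefix_rfl
  have h2 := hp.length_le
  simp at this h2
  simp [this] at h2

/-- The tail of a marking string marks an edge itself, so the shortest represented string qualifies
at once; the parent does not depend on the text. -/
theorem isSuf_cons_cons {T f : List σ} {a b : σ} {e : List σ} (h : IsInternal T (a :: b :: e)) :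
    IsSuf T (a :: b :: e) f ↔ f = b :: e := by
  have key : SufCandidate T (a :: b :: e) (b :: e) := by
    obtain ⟨V, hV⟩ := h
    exact ⟨a, V, hV, List.prefix_rfl, hV.2.2.1, hV.1.tail, by simp⟩
  have hlen : ∀ B, SufCandidate T (a :: b :: e) B → (b :: e).length ≤ B.length := by
    rintro B ⟨a', V, -, hp, -⟩
    have := hp.length_le
    simpa using this
  constructor
  · rintro ⟨⟨a', V, hV, hp, -, -⟩, hmin⟩
    have h1 := hmin _ key
    have h2 := hp.eq_of_length_le (by simpa using h1)
    simpa using (List.cons.inj h2).2.symm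
  · rintro rfl
    exact ⟨key, hlen⟩

theorem isSuf_node {T f : List σ} {c : σ} (h : IsInternal T [c]) (hc : IsNode T [c]) :
    IsSuf T [c] f ↔ f = [] := by
  have hV : ∀ V, HasEndpoint T [c] V → V = [c] := by
    intro V hV
    have := hV.2.2.2 [c] hc List.prefix_rfl
    exact (hV.2.2.1.eq_of_length_le this).symm
  constructor
  · rintro ⟨⟨a, V, hV', hp, hp', -⟩, -⟩
    rw [hV V hV'] at hp'
    have := hp'.length_le
    simpa using this
  · rintro rfl
    obtain ⟨V, hV'⟩ := h
    have := hV V hV'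
    subst this
    exact ⟨⟨c, [c], hV', List.prefix_rfl, List.prefix_rfl, Or.inl rfl, by simp⟩, by simp⟩

/-- When `[c]` does not branch, the edge continues with the only symbol that follows `c`, and this
symbol marks an edge leaving the root. -/
theorem isSuf_not_node {T f : List σ} {c : σ} (h : IsInternal T [c]) (hc : ¬ IsNode T [c]) :
    IsSuf T [c] f ↔ ∃ d, f = [d] ∧ [c, d] <:+: T := by
  have key : ∀ V, HasEndpoint T [c] V → ∃ d, [c, d] <:+: T ∧ SufCandidate T [c] [d] := by
    intro V hV
    obtain ⟨d, W, rfl, hd⟩ := IsNode.isInfix_of_not hc hV.2.1 hV.2.2.1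
    refine ⟨d, hd, c, _, hV, ⟨[d], rfl⟩, ⟨W, rfl⟩, ?_, by simp⟩
    exact Or.inr ⟨[], d, isNode_nil T, rfl, (List.IsSuffix.isInfix ⟨[c], rfl⟩).trans hd⟩
  have hlen : ∀ B, SufCandidate T [c] B → 1 ≤ B.length := by
    rintro B ⟨a, V, hV, hp, -, -, hB⟩
    -- The candidate ⊤ would require an endpoint of length one, which makes `[c]` a node.
    by_contra hlt
    have : B = [] := List.length_eq_zero_iff.1 (by omega)
    have h1 := hB this
    apply hc
    have := hV.2.2.1.eq_of_length_le (by simp [h1])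
    rw [this]
    exact hV.2.1
  constructor
  · rintro ⟨⟨a, V, hV, hp, hp', hm, hA⟩, hmin⟩
    obtain ⟨d, hd, hc'⟩ := key V hV
    have h1 := hmin _ hc'
    have h2 := hlen f ⟨a, V, hV, hp, hp', hm, hA⟩
    obtain ⟨d', rfl⟩ := List.length_eq_one_iff.1 (le_antisymm (by simpa using h1) h2)
    obtain ⟨rfl, -⟩ := List.cons_prefix_cons.1 hp
    exact ⟨d', rfl, hp'.isInfix.trans hV.2.1.isInfix⟩
  · rintro ⟨d, rfl, hd⟩
    obtain ⟨V, hV⟩ := h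
    obtain ⟨d', hd', hc'⟩ := key V hV
    obtain rfl := follow_unique hc hd hd'
    exact ⟨hc', by simpa using hlen⟩

theorem isSuf_of_two_le {T e f : List σ} (h : IsInternal T e) (hl : 2 ≤ e.length) :
    IsSuf T e f ↔ f = e.tail := by
  match e, hl with
  | a :: b :: e, _ => simpa using isSuf_cons_cons h

theorem IsSuf.unique {T e f f' : List σ} (h : IsSuf T e f) (h' : IsSuf T e f') : f = f' := by
  have hi := h.isInternal
  match e, hi, h.ne_nil with
  | [c], hi, _ =>
    by_cases hc : IsNode T [c]
    · rw [isSuf_node hi hc] at h h'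
      rw [h, h']
    · rw [isSuf_not_node hi hc] at h h'
      obtain ⟨d, rfl, hd⟩ := h
      obtain ⟨d', rfl, hd'⟩ := h'
      rw [follow_unique hc hd hd']
  | a :: b :: e, hi, _ =>
    rw [isSuf_cons_cons hi] at h h'
    rw [h, h']

theorem IsInternal.exists_isSuf {T e : List σ} (h : IsInternal T e) (hne : e ≠ []) :
    ∃ f, IsSuf T e f := by
  match e, h, hne with
  | [c], h, _ =>
    by_cases hc : IsNode T [c]
    · exact ⟨[], (isSuf_node h hc).2 rfl⟩
    · obtain ⟨-, W, hW, hp⟩ := isInternal_iff.1 h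
      obtain ⟨d, W', rfl, hd⟩ := IsNode.isInfix_of_not hc hW hp
      exact ⟨[d], (isSuf_not_node h hc).2 ⟨d, rfl, hd⟩⟩
  | a :: b :: e, h, _ => exact ⟨_, (isSuf_cons_cons h).2 rfl⟩

/-- A suffix link drops the first symbol of every node below. -/
theorem IsSuf.tail_below {T e f W : List σ} (h : IsSuf T e f) (hW : IsNode T W) (hp : e <+: W) :
    f <+: W.tail := by
  have hi := h.isInternal
  match e, hi, h.ne_nil with
  | [c], hi, _ =>
    by_cases hc : IsNode T [c]
    · rw [isSuf_node hi hc] at h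
      subst h; exact List.nil_prefix
    · rw [isSuf_not_node hi hc] at h
      obtain ⟨d, rfl, hd⟩ := h
      obtain ⟨d', W', rfl, hd'⟩ := IsNode.isInfix_of_not hc hW hp
      obtain rfl := follow_unique hc hd hd'
      exact ⟨W', rfl⟩
  | a :: b :: e, hi, _ =>
    rw [isSuf_cons_cons hi] at h
    subst h
    obtain ⟨X, rfl⟩ := hp
    exact ⟨X, rfl⟩

theorem IsSuf.isInternal_right {T e f : List σ} (h : IsSuf T e f) : IsInternal T f := by
  obtain ⟨-, W, hW, hp⟩ := isInternal_iff.1 h.isInternal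
  refine isInternal_iff.2 ⟨?_, W.tail, hW.of_suffix (List.tail_suffix W), h.tail_below hW hp⟩
  obtain ⟨⟨a, V, -, -, -, hm, -⟩, -⟩ := h
  exact hm

/-- The length of the endpoint of an internal edge. -/
noncomputable def endLength (T e : List σ) : ℕ :=
  sInf {n | ∃ W, IsNode T W ∧ e <+: W ∧ W.length = n}

/-- This makes the parent relation well-founded. The length of the marking string would not do,
since a one-symbol edge may have a one-symbol parent. -/
theorem IsSuf.endLength_lt {T e f : List σ} (h : IsSuf T e f) : endLength T f < endLength T e := by
  obtain ⟨-, W₀, hW₀, hp₀⟩ := isInternal_iff.1 h.isInternal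
  obtain ⟨W, hW, hp, hl⟩ := Nat.sInf_mem
    (⟨_, W₀, hW₀, hp₀, rfl⟩ : {n | ∃ W, IsNode T W ∧ e <+: W ∧ W.length = n}.Nonempty)
  have h1 : endLength T f ≤ W.tail.length :=
    Nat.sInf_le ⟨W.tail, hW.of_suffix (List.tail_suffix W), h.tail_below hW hp, rfl⟩
  have h2 : 0 < W.length := lt_of_lt_of_le (List.length_pos_iff.2 h.ne_nil) hp.length_le
  have h3 : W.length = endLength T e := hl
  rw [List.length_tail] at h1
  omega

/-- A suffix link never leads from an edge of length at most one to a longer edge. -/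
theorem IsSuf.length_le {T e f : List σ} (h : IsSuf T e f) : f.length ≤ e.length := by
  have hi := h.isInternal
  match e, hi, h.ne_nil with
  | [c], hi, _ =>
    by_cases hc : IsNode T [c]
    · rw [isSuf_node hi hc] at h
      simp [h]
    · rw [isSuf_not_node hi hc] at h
      obtain ⟨d, rfl, -⟩ := h
      simp
  | a :: b :: e, hi, _ =>
    rw [isSuf_cons_cons hi] at h
    simp [h]

/-! ### Ancestors -/

theorem IsAncestor.refl (T e : List σ) : IsAncestor T e e := Relation.ReflTransGen.refl

theorem IsAncestor.trans {T a b c : List σ} (h : IsAncestor T a b) (h' : IsAncestor T b c) :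
    IsAncestor T a c := Relation.ReflTransGen.trans h' h

theorem IsSuf.isAncestor {T e f : List σ} (h : IsSuf T e f) : IsAncestor T f e :=
  Relation.ReflTransGen.single h

theorem IsAncestor.endLength_le {T a e : List σ} (h : IsAncestor T a e) :
    endLength T a ≤ endLength T e := by
  induction h with
  | refl => exact le_rfl
  | tail _ h ih => exact h.endLength_lt.le.trans ih

theorem IsAncestor.isInternal {T a e : List σ} (h : IsAncestor T a e) (he : IsInternal T e) :
    IsInternal T a := by
  induction h with
  | refl => exact he
  | tail _ h _ => exact h.isInternal_right

theorem IsSuf.not_isAncestor {T e f : List σ} (h : IsSuf T e f) : ¬ IsAncestor T e f :=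
  fun h' => absurd h.endLength_lt (not_lt.2 h'.endLength_le)

theorem IsAncestor.antisymm {T a b : List σ} (h : IsAncestor T a b) (h' : IsAncestor T b a) :
    a = b := by
  rcases Relation.ReflTransGen.cases_head h with rfl | ⟨c, hc, hc'⟩
  · rfl
  · exact absurd (IsAncestor.trans h' hc') hc.not_isAncestor

/-- A proper ancestor of `e` is an ancestor of the parent of `e`. -/
theorem IsAncestor.of_isSuf {T a e f : List σ} (h : IsAncestor T a e) (hf : IsSuf T e f)
    (hne : a ≠ e) : IsAncestor T a f := by
  rcases Relation.ReflTransGen.cases_head h with rfl | ⟨c, hc, hc'⟩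
  · exact absurd rfl hne
  · rwa [hf.unique hc]

theorem IsInternal.isAncestor_nil {T e : List σ} (h : IsInternal T e) : IsAncestor T [] e := by
  induction hn : endLength T e using Nat.strong_induction_on generalizing e with
  | _ n ih =>
    by_cases hne : e = []
    · subst hne; exact IsAncestor.refl T []
    · obtain ⟨f, hf⟩ := h.exists_isSuf hne
      exact (ih _ (hn ▸ hf.endLength_lt) hf.isInternal_right rfl).trans hf.isAncestor

theorem IsAncestor.eq_nil {T a : List σ} (h : IsAncestor T a []) : a = [] := by
  rcases Relation.ReflTransGen.cases_head h with rfl | ⟨c, hc, -⟩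
  · rfl
  · exact absurd rfl hc.ne_nil

/-- Climbing from `e`, the first ancestor that is also an ancestor of `f` is lowest; the climb ends
at ⊤ at the latest. -/
theorem exists_isLCA {T e f : List σ} (he : IsInternal T e) (hf : IsInternal T f) :
    ∃ g, IsLCA T e f g := by
  induction hn : endLength T e using Nat.strong_induction_on generalizing e with
  | _ n ih =>
    by_cases h : IsAncestor T e f
    · exact ⟨e, IsAncestor.refl T e, h, fun c hc _ => hc⟩
    · have hne : e ≠ [] := by rintro rfl; exact h hf.isAncestor_nil
      obtain ⟨e', he'⟩ := he.exists_isSuf hne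
      obtain ⟨g, hg, hg', hc⟩ := ih _ (hn ▸ he'.endLength_lt) he'.isInternal_right rfl
      refine ⟨g, hg.trans he'.isAncestor, hg', fun c hce hcf => hc c ?_ hcf⟩
      exact hce.of_isSuf he' (by rintro rfl; exact h hcf)

theorem IsAncestor.exists_child {T g f : List σ} (h : IsAncestor T g f) (hne : g ≠ f) :
    ∃ k, IsSuf T k g ∧ IsAncestor T k f := by
  rcases Relation.ReflTransGen.cases_tail h with h | ⟨k, hk, hk'⟩
  · exact absurd h hne
  · exact ⟨k, hk', hk⟩

theorem IsLCA.not_isAncestor {T e f g k : List σ} (h : IsLCA T e f g) (hk : IsSuf T k g)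
    (hkf : IsAncestor T k f) : ¬ IsAncestor T k e :=
  fun hke => hk.not_isAncestor (h.2.2 k hke hkf)

/-! ### Long edges: ancestors are suffixes -/

/-- Lengths never grow on the way up, so a path that ends at a long edge consists of long edges,
where every link is a tail. -/
theorem IsAncestor.suffix {T a e : List σ} (h : IsAncestor T a e) (ha : 2 ≤ a.length) :
    a <:+ e := by
  induction h using Relation.ReflTransGen.head_induction_on with
  | refl => exact List.suffix_rfl
  | head h _ ih =>
    rw [isSuf_of_two_le h.isInternal (ha.trans (ih.length_le.trans h.length_le))] at h
    subst h
    exact ih.trans (List.tail_suffix _)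

theorem IsInternal.isAncestor_of_suffix {T a e : List σ} (he : IsInternal T e) (h : a <:+ e)
    (ha : a ≠ []) : IsAncestor T a e := by
  induction e with
  | nil => exact absurd (List.suffix_nil.1 h) ha
  | cons c e ih =>
    rcases List.suffix_cons_iff.1 h with rfl | h
    · exact IsAncestor.refl _ _
    · have hl : 1 ≤ e.length := (List.length_pos_iff.2 ha).trans_le h.length_le
      have hs : IsSuf T (c :: e) e := (isSuf_of_two_le he (by simpa using hl)).2 rfl
      exact (ih he.tail h).trans hs.isAncestor

theorem IsInternal.isAncestor_iff {T a e : List σ} (he : IsInternal T e) (ha : 2 ≤ a.length) :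
    IsAncestor T a e ↔ a <:+ e :=
  ⟨fun h => h.suffix ha, fun h => he.isAncestor_of_suffix h (by rintro rfl; simp at ha)⟩

/-- An ancestor with at most one symbol is an ancestor of the last symbol. -/
theorem IsAncestor.of_suffix {T a e f : List σ} (he : IsInternal T e) (h : IsAncestor T a e)
    (ha : a.length ≤ 1) (hf : f <:+ e) (hf0 : f ≠ []) : IsAncestor T a f := by
  induction e with
  | nil => exact absurd (List.suffix_nil.1 hf) hf0
  | cons c e ih =>
    rcases List.suffix_cons_iff.1 hf with rfl | hf
    · exact h
    · have hl : 1 ≤ e.length := (List.length_pos_iff.2 hf0).trans_le hf.length_le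
      have hs : IsSuf T (c :: e) e := (isSuf_of_two_le he (by simpa using hl)).2 rfl
      refine ih he.tail (h.of_isSuf hs ?_) hf
      rintro rfl
      simp at ha
      simp [ha] at hl

theorem IsAncestor.length_le {T a e : List σ} (h : IsAncestor T a e) : a.length ≤ e.length := by
  induction h with
  | refl => exact le_rfl
  | tail _ h ih => exact h.length_le.trans ih

end SufTree

/-! ### Counting edges, subtree weights, and time bounds for programs. -/

namespace SufTree

variable {σ : Type*}

/-! ### The number of internal edges -/

/-- `q` is the start of an occurrence of `V` that is followed by another symbol than an earlier
occurrence of `V`. -/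
def BranchesAt (T V : List σ) (q : ℕ) : Prop :=
  ∃ p < q, ∃ a b, a ≠ b ∧ V ++ [a] <+: T.drop p ∧ V ++ [b] <+: T.drop q

theorem exists_prefix_drop {A T : List σ} (h : A <:+: T) : ∃ p, A <+: T.drop p := by
  obtain ⟨X, Y, rfl⟩ := h
  exact ⟨X.length, Y, by simp⟩

theorem eq_of_append_prefix {V X : List σ} {a b : σ} (ha : V ++ [a] <+: X) (hb : V ++ [b] <+: X) :
    a = b := by
  have := (List.prefix_of_prefix_length_le ha hb (by simp)).eq_of_length (by simp)
  simpa using this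

theorem branchesAt_max {T V : List σ} {a b : σ} {p q : ℕ} (hab : a ≠ b)
    (hp : V ++ [a] <+: T.drop p) (hq : V ++ [b] <+: T.drop q) : BranchesAt T V (max p q) := by
  rcases lt_trichotomy p q with h | rfl | h
  · rw [max_eq_right h.le]
    exact ⟨p, h, a, b, hab, hp, hq⟩
  · exact absurd (eq_of_append_prefix hp hq) hab
  · rw [max_eq_left h.le]
    exact ⟨q, h, b, a, hab.symm, hq, hp⟩

theorem IsNode.exists_branchesAt {T V : List σ} (h : IsNode T V) (hV : V ≠ []) :
    ∃ q, BranchesAt T V q := by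
  rcases h with h | ⟨a, b, hab, ha, hb⟩
  · exact absurd h hV
  · obtain ⟨p, hp⟩ := exists_prefix_drop ha
    obtain ⟨q, hq⟩ := exists_prefix_drop hb
    exact ⟨_, branchesAt_max hab hp hq⟩

theorem BranchesAt.lt_length {T V : List σ} {q : ℕ} (h : BranchesAt T V q) : q < T.length := by
  obtain ⟨p, -, a, b, -, -, hb⟩ := h
  have := hb.length_le
  simp at this
  omega

/-- The least position at which `V` branches determines `V`. -/
theorem BranchesAt.length_le {T V W : List σ} {q : ℕ} (hV : BranchesAt T V q)
    (hmin : ∀ p, BranchesAt T V p → q ≤ p) (hW : BranchesAt T W q) : W.length ≤ V.length := by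
  by_contra hlt
  obtain ⟨p, hp, a, b, hab, ha, hb⟩ := hV
  obtain ⟨p', hp', a', b', -, ha', hb'⟩ := hW
  have h1 : V ++ [b] <+: W ++ [b'] :=
    List.prefix_of_prefix_length_le hb hb' (by simp; omega)
  have h2 : V ++ [b] <+: W :=
    List.prefix_of_prefix_length_le h1 (List.prefix_append W [b']) (by simp; omega)
  -- The longer `W` carries `V ++ [b]` to its own earlier occurrence at `p'`. Together with `V ++
  -- [a]` at `p`, this lets `V` branch at `max p p'`, before `q`.
  have h3 := (h2.trans (List.prefix_append W [a'])).trans ha'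
  have := hmin _ (branchesAt_max hab ha h3)
  omega

theorem HasEndpoint.length_le {T e e' V : List σ} (h : HasEndpoint T e V)
    (h' : HasEndpoint T e' V) : e'.length ≤ e.length := by
  by_contra hlt
  rcases h'.1 with rfl | ⟨U, c, hU, rfl, -⟩
  · simp at hlt
  · have h1 := (List.prefix_append U [c]).trans h'.2.2.1
    have h2 := List.prefix_of_prefix_length_le h.2.2.1 h1 (by simp at hlt; omega)
    have h3 := h.2.2.2 U hU h2
    have h4 := h'.2.2.1.length_le
    simp at h4
    omega

/-- Two edges with the same endpoint are prefixes of it, and a longer one would start at a node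
lying on the shorter one before that endpoint. -/
theorem HasEndpoint.injective {T e e' V : List σ} (h : HasEndpoint T e V)
    (h' : HasEndpoint T e' V) : e = e' :=
  (List.prefix_of_prefix_length_le h.2.2.1 h'.2.2.1 (h'.length_le h)).eq_of_length
    (le_antisymm (h'.length_le h) (h.length_le h'))

open Classical in
/-- The internal edges of the suffix tree of `T`. -/
noncomputable def edges (T : List σ) : Finset (Edge σ) :=
  T.sublists.toFinset.filter (IsInternal T)

theorem mem_edges {T e : List σ} : e ∈ edges T ↔ IsInternal T e := by
  classical
  simp only [edges, Finset.mem_filter, List.mem_toFinset, List.mem_sublists, and_iff_right_iff_imp]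
  exact fun h => h.isInfix.sublist

/-- Edges inject into endpoints, and nonempty endpoints into their least branching positions, which
are below the length of the text. -/
theorem card_edges_le (T : List σ) : (edges T).card ≤ T.length + 1 := by
  classical
  have hend : ∀ e ∈ edges T, ∃ V, HasEndpoint T e V := fun e he => mem_edges.1 he
  choose! V hV using hend
  -- The root has no branching position of its own here; it receives the one value that no other
  -- node takes.
  let q : Edge σ → ℕ := fun e => if V e = [] then T.length else sInf {q | BranchesAt T (V e) q}
  have hq : ∀ e ∈ edges T, V e ≠ [] → BranchesAt T (V e) (q e) ∧
      ∀ p, BranchesAt T (V e) p → q e ≤ p := by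
    intro e he hne
    have hq' : q e = sInf {q | BranchesAt T (V e) q} := if_neg hne
    rw [hq']
    exact ⟨Nat.sInf_mem (s := {q | BranchesAt T (V e) q})
      ((hV e he).2.1.exists_branchesAt hne), fun p hp => Nat.sInf_le hp⟩
  have key : ∀ e ∈ edges T, ∀ e' ∈ edges T, q e = q e' → V e = V e' := by
    intro e he e' he' hqq
    by_cases h : V e = [] <;> by_cases h' : V e' = []
    · rw [h, h']
    · have h1 := (hq e' he' h').1.lt_length
      have h2 : q e = T.length := if_pos h
      omega
    · have h1 := (hq e he h).1.lt_length
      have h2 : q e' = T.length := if_pos h'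
      omega
    · obtain ⟨h1, h2⟩ := hq e he h
      obtain ⟨h3, h4⟩ := hq e' he' h'
      rw [← hqq] at h3 h4
      have h5 := le_antisymm (h3.length_le h4 h1) (h1.length_le h2 h3)
      obtain ⟨-, -, -, b, -, -, hb⟩ := h1
      obtain ⟨-, -, -, b', -, -, hb'⟩ := h3
      exact (List.prefix_of_prefix_length_le ((List.prefix_append _ _).trans hb)
        ((List.prefix_append _ _).trans hb') h5.le).eq_of_length h5
  calc (edges T).card ≤ (Finset.range (T.length + 1)).card := by
        refine Finset.card_le_card_of_injOn q ?_ ?_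
        · intro e he
          have he : e ∈ edges T := he
          simp only [Finset.coe_range, Set.mem_Iio]
          by_cases h : V e = []
          · have : q e = T.length := if_pos h
            omega
          · have := (hq e he h).1.lt_length
            omega
        · intro e he e' he' hqq
          have h1 := key e he e' he' hqq
          have h2 := hV e' he'
          rw [← h1] at h2
          exact (hV e he).injective h2
    _ = T.length + 1 := Finset.card_range _

/-! ### Weights -/

section Weight

variable (E : Finset (List σ))

open Classical in
/-- The number of strings in `E` that have the suffix `v`. -/
noncomputable def weight (v : List σ) : ℕ := (E.filter fun x => v <:+ x).card

open Classical in
/-- The weight of `r` without the heaviest part below `r` that avoids the path to `x`. -/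
noncomputable def slack (r x : List σ) : ℕ :=
  weight E r - (E.filter fun v => r <:+ v ∧ ¬ v <:+ x).sup (weight E)

variable {E}

theorem weight_le_card (v : List σ) : weight E v ≤ E.card := by
  classical
  exact Finset.card_filter_le _ _

theorem weight_pos {v : List σ} (h : v ∈ E) : 0 < weight E v := by
  classical
  exact Finset.card_pos.2 ⟨v, Finset.mem_filter.2 ⟨h, List.suffix_rfl⟩⟩

theorem weight_anti {v v' : List σ} (h : v <:+ v') : weight E v' ≤ weight E v := by
  classical
  exact Finset.card_le_card fun x hx => by
    rw [Finset.mem_filter] at hx ⊢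
    exact ⟨hx.1, h.trans hx.2⟩

theorem weight_lt {v v' : List σ} (hv : v ∈ E) (h : v <:+ v') (hne : v ≠ v') :
    weight E v' < weight E v := by
  classical
  refine Finset.card_lt_card ?_
  rw [Finset.ssubset_iff_of_subset]
  · refine ⟨v, Finset.mem_filter.2 ⟨hv, List.suffix_rfl⟩, fun hm => hne ?_⟩
    exact h.eq_of_length_le (Finset.mem_filter.1 hm).2.length_le
  · intro x hx
    rw [Finset.mem_filter] at hx ⊢
    exact ⟨hx.1, h.trans hx.2⟩

/-- Incomparable strings below `r` have disjoint parts. -/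
theorem weight_add_le {r v v' : List σ} (hv : r <:+ v) (hv' : r <:+ v') (h : ¬ v <:+ v')
    (h' : ¬ v' <:+ v) : weight E v + weight E v' ≤ weight E r := by
  classical
  unfold weight
  rw [← Finset.card_union_of_disjoint]
  · refine Finset.card_le_card fun x hx => ?_
    rw [Finset.mem_union, Finset.mem_filter, Finset.mem_filter] at hx
    rw [Finset.mem_filter]
    rcases hx with hx | hx
    · exact ⟨hx.1, hv.trans hx.2⟩
    · exact ⟨hx.1, hv'.trans hx.2⟩
  · rw [Finset.disjoint_left]
    intro x hx hx'
    rcases List.suffix_or_suffix_of_suffix (Finset.mem_filter.1 hx).2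
      (Finset.mem_filter.1 hx').2 with h1 | h1
    · exact h h1
    · exact h' h1

theorem slack_le_weight (r x : List σ) : slack E r x ≤ weight E r := Nat.sub_le _ _

theorem slack_le {r x v : List σ} (hv : v ∈ E) (hr : r <:+ v) (hx : ¬ v <:+ x) :
    slack E r x ≤ weight E r - weight E v := by
  classical
  unfold slack
  have : weight E v ≤ (E.filter fun v => r <:+ v ∧ ¬ v <:+ x).sup (weight E) :=
    Finset.le_sup (f := weight E) (Finset.mem_filter.2 ⟨hv, hr, hx⟩)
  omega

theorem le_slack {r x : List σ} {n : ℕ} (hn : n ≤ weight E r)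
    (h : ∀ v ∈ E, r <:+ v → ¬ v <:+ x → n + weight E v ≤ weight E r) : n ≤ slack E r x := by
  classical
  have : (E.filter fun v => r <:+ v ∧ ¬ v <:+ x).sup (weight E) ≤ weight E r - n := by
    refine Finset.sup_le fun v hv => ?_
    rw [Finset.mem_filter] at hv
    have := h v hv.1 hv.2.1 hv.2.2
    omega
  unfold slack
  omega

theorem slack_pos {r x : List σ} (hr : r ∈ E) (hx : r <:+ x) : 0 < slack E r x := by
  refine le_slack (weight_pos hr) fun v _ hv hvx => ?_
  have := weight_lt hr hv (by rintro rfl; exact hvx hx)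
  omega

/-- Rerouting `r` from `f` to `e`, where `h` is a point on the path to `f` that the path to `e`
avoids, loses enough slack. -/
theorem slack_mul_le {r h e f : List σ} (hh : h ∈ E) (hrh : r <:+ h)
    (hhf : h <:+ f) (hhe : ¬ h <:+ e) :
    4 * (slack E r e * slack E h f * weight E h ^ 2) ≤ slack E r f ^ 2 * weight E r ^ 2 := by
  have hwle : weight E h ≤ weight E r := weight_anti hrh
  -- Here `a` is the weight of `r` outside `h`. The path to `e` avoids `h`, so the slack of `r`
  -- towards `e` is at most `a`.
  obtain ⟨a, ha⟩ := Nat.exists_eq_add_of_le hwle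
  have h1 : slack E r e ≤ a := by
    have := slack_le hh hrh hhe
    omega
  have h2 : slack E h f ≤ weight E h := slack_le_weight _ _
  -- A part below `r` off the path to `f` either lies below `h`, where the slack of `h` is missing
  -- from it, or is disjoint from the part of `h`.
  have h3 : min (weight E h) (a + slack E h f) ≤ slack E r f := by
    refine le_slack (by omega) fun v hv hrv hvf => ?_
    by_cases hhv : h <:+ v
    · have := slack_le hv hhv hvf
      have := weight_anti (E := E) hhv
      omega
    · have := weight_add_le (E := E) hrv hrh (fun h' => hvf (h'.trans hhf)) hhv
      omega
  generalize weight E h = w at *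
  generalize slack E h f = b at *
  generalize slack E r e = x at *
  generalize slack E r f = y at *
  rw [ha]
  have hx : 4 * (x * b * w ^ 2) ≤ 4 * (a * b * w ^ 2) := by gcongr
  refine hx.trans ?_
  -- Both cases are the inequality 4xy ≤ (x + y)², for `a`, `w` and for `a`, `b`.
  rcases min_le_iff.1 h3 with h3 | h3
  · calc 4 * (a * b * w ^ 2) ≤ 4 * (a * w * w ^ 2) := by gcongr
      _ ≤ w ^ 2 * (w + a) ^ 2 := by
        have : 4 * (a * w) ≤ (w + a) ^ 2 := by
          zify; nlinarith [sq_nonneg ((w : ℤ) - a)]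
        nlinarith [Nat.zero_le (w ^ 2)]
      _ ≤ y ^ 2 * (w + a) ^ 2 := by gcongr
  · calc 4 * (a * b * w ^ 2) ≤ (a + b) ^ 2 * w ^ 2 := by
          have : 4 * (a * b) ≤ (a + b) ^ 2 := by
            zify; nlinarith [sq_nonneg ((a : ℤ) - b)]
          nlinarith [Nat.zero_le (w ^ 2)]
      _ ≤ y ^ 2 * (w + a) ^ 2 := by gcongr; omega

/-- Half the binary logarithm of `slack_mul_le`: the factor 4 becomes the unit that pays for one
call. -/
theorem logb_slack_add_le {r h e f : List σ} (hr : r ∈ E) (hh : h ∈ E) (hrh : r <:+ h)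
    (hhf : h <:+ f) (hre : r <:+ e) (hhe : ¬ h <:+ e) :
    1 + Real.logb 2 (slack E r e) / 2 + Real.logb 2 (slack E h f) / 2 + Real.logb 2 (weight E h) ≤
      Real.logb 2 (slack E r f) + Real.logb 2 (weight E r) := by
  have key : (4 : ℝ) * (slack E r e * slack E h f * (weight E h : ℝ) ^ 2) ≤
      (slack E r f : ℝ) ^ 2 * (weight E r : ℝ) ^ 2 := by
    exact_mod_cast slack_mul_le hh hrh hhf hhe
  have p1 : (0 : ℝ) < slack E r e := by exact_mod_cast slack_pos hr hre
  have p2 : (0 : ℝ) < slack E h f := by exact_mod_cast slack_pos hh hhf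
  have p3 : (0 : ℝ) < slack E r f := by exact_mod_cast slack_pos hr (hrh.trans hhf)
  have p4 : (0 : ℝ) < weight E h := by exact_mod_cast weight_pos hh
  have p5 : (0 : ℝ) < weight E r := by exact_mod_cast weight_pos hr
  have h4 : Real.logb 2 4 = 2 := by
    rw [show (4 : ℝ) = 2 ^ (2 : ℕ) by norm_num, Real.logb_pow, Real.logb_self_eq_one (by norm_num)]
    norm_num
  have := Real.logb_le_logb_of_le (b := 2) (by norm_num) (by positivity) key
  rw [Real.logb_mul (by positivity) (by positivity), Real.logb_mul (by positivity) (by positivity),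
    Real.logb_mul (by positivity) (by positivity), Real.logb_mul (by positivity) (by positivity),
    Real.logb_pow, Real.logb_pow, Real.logb_pow, h4] at this
  push_cast at this
  linarith

end Weight

/-! ### Programs that meet a postcondition within a time bound -/

/-- Started in `s`, the program can be executed in at most `n` steps so that `Q` holds. -/
def Prog.Meets [DecidableEq σ] (T : List σ) (P : Prog σ) (s : Config σ) (n : ℕ)
    (Q : Config σ → Prop) : Prop :=
  ∃ s' m, Prog.Exec T P s s' m ∧ m ≤ n ∧ Q s'

section Meets

variable [DecidableEq σ] {T : List σ} {P P' : Prog σ} {s : Config σ} {m n : ℕ}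
  {Q R : Config σ → Prop}

theorem Prog.Meets.mono (h : P.Meets T s m R) (hmn : m ≤ n) (hQ : ∀ s', R s' → Q s') :
    P.Meets T s n Q := by
  obtain ⟨s', k, he, hk, hR⟩ := h
  exact ⟨s', k, he, hk.trans hmn, hQ s' hR⟩

theorem meets_skip (h : Q s) : (Prog.skip : Prog σ).Meets T s 1 Q := ⟨s, 1, .skip s, le_rfl, h⟩

theorem meets_instr {c : Instr σ} {s' : Config σ} (hc : c.Exec T s s') (h : Q s') :
    (Prog.instr c).Meets T s 1 Q := ⟨s', 1, .instr hc, le_rfl, h⟩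

theorem Prog.Meets.seq (h : P.Meets T s m R) (h' : ∀ s', R s' → P'.Meets T s' n Q) :
    (Prog.seq P P').Meets T s (m + n) Q := by
  obtain ⟨s', k, he, hk, hR⟩ := h
  obtain ⟨s'', k', he', hk', hQ⟩ := h' s' hR
  exact ⟨s'', _, .seq he he', by omega, hQ⟩

theorem meets_instr_seq {c : Instr σ} {s' : Config σ} (hc : c.Exec T s s')
    (h : P.Meets T s' n Q) : (Prog.seq (.instr c) P).Meets T s (n + 1) Q := by
  obtain ⟨s'', k', he', hk', hQ⟩ := h
  exact ⟨s'', _, .seq (.instr hc) he', by omega, hQ⟩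

theorem meets_ite {b : Test} (h : b.Holds s → P.Meets T s n Q)
    (h' : ¬ b.Holds s → P'.Meets T s n Q) : (Prog.ite b P P').Meets T s (n + 1) Q := by
  by_cases hb : b.Holds s
  · obtain ⟨s', k, he, hk, hQ⟩ := h hb
    exact ⟨s', _, .iteTrue hb he, by omega, hQ⟩
  · obtain ⟨s', k, he, hk, hQ⟩ := h' hb
    exact ⟨s', _, .iteFalse hb he, by omega, hQ⟩

theorem meets_while_done {b : Test} (hb : b.Holds s) (h : Q s) :
    (Prog.whileNot b P).Meets T s 1 Q := ⟨s, 1, .whileDone hb, le_rfl, h⟩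

/-- A loop whose body decreases a bound `d` on the number of rounds. -/
theorem meets_while {b : Test} {I : Config σ → ℕ → Prop}
    (hbody : ∀ s d, I s d → ¬ b.Holds s → P.Meets T s m fun s' => ∃ d' < d, I s' d')
    {d : ℕ} (hs : I s d) :
    (Prog.whileNot b P).Meets T s ((m + 1) * d + 1) fun s' => b.Holds s' ∧ ∃ d', I s' d' := by
  induction d using Nat.strong_induction_on generalizing s with
  | _ d ih =>
    by_cases hb : b.Holds s
    · exact (meets_while_done hb ⟨hb, d, hs⟩).mono (by omega) fun _ h => h
    · obtain ⟨s', k, he, hk, d', hd', hI⟩ := hbody s d hs hb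
      obtain ⟨s'', k', he', hk', hQ⟩ := ih d' hd' hI
      refine ⟨s'', _, .whileStep hb he he', ?_, hQ⟩
      have : (m + 1) * (d' + 1) ≤ (m + 1) * d := Nat.mul_le_mul_left _ hd'
      rw [mul_add, mul_one] at this
      omega

/-- Amortized analysis of a run: the iterations are chained by an invariant and a potential. -/
theorem exists_isRun {P : Prog σ} {T : List σ} {u : ℕ → Option (Edge σ)}
    (I : ℕ → Config σ → Prop) (pot : ℕ → Config σ → ℝ) (A : ℝ) (h0 : I 0 (Config.init σ))
    (hpot : ∀ i s, 0 ≤ pot i s)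
    (hstep : ∀ i < T.length, ∀ s, I i s → ∃ s' n,
      Prog.Exec (T.take (i + 1)) P (s.setReg 0 ((u (i + 1)).getD topEdge)) s' n ∧
      I (i + 1) s' ∧ (n : ℝ) + pot (i + 1) s' ≤ pot i s + A) :
    ∃ (S : ℕ → Config σ) (n : ℕ → ℕ), IsRun P T u S n ∧ (∀ i ≤ T.length, I i (S i)) ∧
      ((∑ i ∈ Finset.range T.length, n i : ℕ) : ℝ) ≤
        pot 0 (Config.init σ) + A * T.length := by
  choose! f g hf hI hc using hstep
  let S : ℕ → Config σ := fun i => Nat.rec (Config.init σ) (fun i s => f i s) i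
  have hS : ∀ i, S (i + 1) = f i (S i) := fun i => rfl
  have hIS : ∀ i ≤ T.length, I i (S i) := by
    intro i
    induction i with
    | zero => exact fun _ => h0
    | succ i ih => exact fun hi => hI i hi (S i) (ih (by omega))
  refine ⟨S, fun i => g i (S i), ⟨rfl, fun i hi => ?_⟩, hIS, ?_⟩
  · exact hf i hi (S i) (hIS i hi.le)
  · have key : ∀ k ≤ T.length, ((∑ i ∈ Finset.range k, g i (S i) : ℕ) : ℝ) + pot k (S k) ≤
        pot 0 (Config.init σ) + A * k := by
      intro k
      induction k with
      | zero => intro _; simp [S]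
      | succ k ih =>
        intro hk
        have h1 := ih (by omega)
        have h2 := hc k hk (S k) (hIS k (by omega))
        rw [← hS] at h2
        rw [Finset.sum_range_succ]
        push_cast at h1 ⊢
        linarith
    have := key _ le_rfl
    have := hpot T.length (S T.length)
    linarith

end Meets

end SufTree

/-! ### The total time of `reprupd`. -/

namespace SufTree

variable {σ : Type*}

theorem logb_two_nonneg (n : ℕ) : 0 ≤ Real.logb 2 (n : ℝ) := by
  rcases Nat.eq_zero_or_pos n with rfl | h
  · simp
  · exact Real.logb_nonneg (by norm_num) (by exact_mod_cast h)

theorem logb_two_mono {m n : ℕ} (h : m ≤ n) : Real.logb 2 (m : ℝ) ≤ Real.logb 2 (n : ℝ) := by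
  rcases Nat.eq_zero_or_pos m with rfl | hm
  · simpa using logb_two_nonneg n
  · exact Real.logb_le_logb_of_le (by norm_num) (by exact_mod_cast hm) (by exact_mod_cast h)

/-- The pos-updated edges are internal edges of the current tree. -/
theorem IsSchedule.isInternal {T : List σ} {u : ℕ → Option (Edge σ)} (h : IsSchedule T u) {i : ℕ}
    (hi : i < T.length) : IsInternal (T.take (i + 1)) ((u (i + 1)).getD topEdge) := by
  cases hu : u (i + 1) with
  | none => exact isInternal_nil _
  | some e =>
    obtain ⟨-, V, hV, -⟩ := h (i + 1) (by omega) hi e hu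
    exact ⟨V, hV⟩

/-- A time bound in terms of the number of internal edges. -/
theorem mul_logb_card_edges_le {T : List σ} (hT : 2 ≤ T.length) (A B : ℝ) (hA : 0 ≤ A)
    (hB : 0 ≤ B) :
    (A + B * Real.logb 2 (edges T).card) * T.length ≤
      (A + 2 * B) / Real.log 2 * (T.length * Real.log T.length) := by
  have hl2 : 0 < Real.log 2 := Real.log_pos (by norm_num)
  have hN : (2 : ℝ) ≤ T.length := by exact_mod_cast hT
  have h1 : 1 ≤ Real.logb 2 T.length := by
    rw [← Real.logb_self_eq_one (b := 2) (by norm_num)]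
    exact Real.logb_le_logb_of_le (by norm_num) (by norm_num) hN
  have h2 : Real.logb 2 (edges T).card ≤ 2 * Real.logb 2 T.length := by
    -- From N ≥ 2 follows N + 1 ≤ N², which costs a factor 2 in the logarithm.
    have h3 : (edges T).card ≤ T.length ^ 2 := (card_edges_le T).trans (by nlinarith)
    have h4 := logb_two_mono h3
    push_cast at h4
    rw [Real.logb_pow] at h4
    exact_mod_cast h4
  have h3 : A + B * Real.logb 2 (edges T).card ≤ (A + 2 * B) * Real.logb 2 T.length := by
    nlinarith
  calc _ ≤ (A + 2 * B) * Real.logb 2 T.length * T.length := by gcongr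
    _ = _ := by rw [Real.logb]; field_simp

/-! ### One-symbol edges -/

section Depth

variable [Fintype σ]

open Classical in
/-- The number of one-symbol ancestors of `y`. -/
noncomputable def depth (T y : List σ) : ℕ :=
  (Finset.univ.filter fun d : σ => IsAncestor T [d] y).card

open Classical in
/-- The number of symbols whose value `repr` has been moved elsewhere in the link tree. -/
noncomputable def numMoved (T : List σ) (ρ : Edge σ → Edge σ) : ℕ :=
  (Finset.univ.filter fun c : σ => ¬ IsAncestor T [c] (ρ [c])).card

theorem depth_le (T y : List σ) : depth T y ≤ Fintype.card σ := by
  classical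
  exact Finset.card_filter_le _ _

theorem numMoved_le (T : List σ) (ρ : Edge σ → Edge σ) : numMoved T ρ ≤ Fintype.card σ := by
  classical
  exact Finset.card_filter_le _ _

theorem depth_lt {T y : List σ} {c : σ} (h : IsAncestor T y [c]) (hne : y ≠ [c]) :
    depth T y < depth T [c] := by
  classical
  refine Finset.card_lt_card ?_
  rw [Finset.ssubset_iff_of_subset]
  · refine ⟨c, by simp [IsAncestor.refl], fun hc => hne ?_⟩
    exact h.antisymm (Finset.mem_filter.1 hc).2
  · intro d hd
    rw [Finset.mem_filter] at hd ⊢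
    exact ⟨hd.1, hd.2.trans h⟩

end Depth

/-! ### The procedure `reprupd` -/

/-- The potential of a value `repr r = x`. -/
noncomputable def pathPot (E : Finset (List σ)) (r x : List σ) : ℝ :=
  if x.isEmpty then 0 else Real.logb 2 (slack E r x)

theorem pathPot_nonneg (E : Finset (List σ)) (r x : List σ) : 0 ≤ pathPot E r x := by
  unfold pathPot
  split
  · exact le_rfl
  · exact logb_two_nonneg _

theorem pathPot_of_ne_nil (E : Finset (List σ)) (r : List σ) {x : List σ} (h : x ≠ []) :
    pathPot E r x = Real.logb 2 (slack E r x) := by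
  unfold pathPot
  rw [if_neg]
  simpa using h

/-- The potential of the values `repr` at long edges. -/
noncomputable def reprPot (E : Finset (List σ)) (ρ : Edge σ → Edge σ) : ℝ :=
  ∑ r ∈ E.filter fun r => 2 ≤ r.length, pathPot E r (ρ r)

theorem reprPot_nonneg (E : Finset (List σ)) (ρ : Edge σ → Edge σ) : 0 ≤ reprPot E ρ :=
  Finset.sum_nonneg fun _ _ => pathPot_nonneg _ _ _

theorem reprPot_update_short [DecidableEq σ] (E : Finset (List σ)) (ρ : Edge σ → Edge σ)
    {r : List σ} (e : List σ) (hr : ¬ 2 ≤ r.length) :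
    reprPot E (Function.update ρ r e) = reprPot E ρ := by
  refine Finset.sum_congr rfl fun r' hr' => ?_
  rw [Function.update_of_ne]
  rintro rfl
  exact hr (Finset.mem_filter.1 hr').2

theorem reprPot_update [DecidableEq σ] {E : Finset (List σ)} (ρ : Edge σ → Edge σ) {r : List σ}
    (e : List σ) (hrE : r ∈ E) (hr : 2 ≤ r.length) :
    reprPot E (Function.update ρ r e) = reprPot E ρ - pathPot E r (ρ r) + pathPot E r e := by
  have hm : r ∈ E.filter fun r => 2 ≤ r.length := Finset.mem_filter.2 ⟨hrE, hr⟩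
  unfold reprPot
  rw [← Finset.add_sum_erase _ _ hm, ← Finset.add_sum_erase _ (fun x => pathPot E x (ρ x)) hm,
    Function.update_self]
  have : ∑ x ∈ (E.filter fun r => 2 ≤ r.length).erase r, pathPot E x (Function.update ρ r e x) =
      ∑ x ∈ (E.filter fun r => 2 ≤ r.length).erase r, pathPot E x (ρ x) := by
    refine Finset.sum_congr rfl fun x hx => ?_
    rw [Function.update_of_ne (Finset.mem_erase.1 hx).1]
  rw [this]
  ring

/-- The invariant of the values `repr` under `reprupd`. -/
structure ReprInv (T : List σ) (ρ : Edge σ → Edge σ) : Prop where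
  isInternal : ∀ r, IsInternal T (ρ r)
  suffix : ∀ r, 2 ≤ r.length → ρ r ≠ [] → r <:+ ρ r

theorem ReprInv.mono {T T' : List σ} {ρ : Edge σ → Edge σ} (h : ReprInv T ρ) (hT : T <:+: T') :
    ReprInv T' ρ := ⟨fun r => (h.isInternal r).mono hT, h.suffix⟩

theorem ReprInv.update [DecidableEq σ] {T : List σ} {ρ : Edge σ → Edge σ} (h : ReprInv T ρ)
    {r e : List σ} (he : IsInternal T e) (hr : IsAncestor T r e) :
    ReprInv T (Function.update ρ r e) := by
  constructor
  · intro r'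
    by_cases hr' : r' = r
    · rwa [hr', Function.update_self]
    · rw [Function.update_of_ne hr']
      exact h.isInternal r'
  · intro r' hl
    by_cases hr' : r' = r
    · subst hr'
      rw [Function.update_self]
      exact fun _ => hr.suffix hl
    · rw [Function.update_of_ne hr']
      exact h.suffix r' hl

/-- The registers before a call `reprupd(e, r)`. -/
structure AtCall (T : List σ) (s : Config σ) (e r : List σ) : Prop where
  inv : ReprInv T s.repr
  reg_zero : s.reg 0 = e
  reg_one : s.reg 1 = r
  reg_four : s.reg 4 ≠ []
  ne_nil : e ≠ []
  isInternal : IsInternal T e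
  isAncestor : IsAncestor T r e

variable [DecidableEq σ]

/-- The next argument `h` is not an ancestor of `e`, being a child of the lowest common ancestor on
the side of `f`. It lies below `r` only if `f` does, which can fail when `r` has one symbol. -/
theorem reprupdCall_meets {T : List σ} {s : Config σ} {e r : List σ} (hs : AtCall T s e r) :
    (reprupdCall σ).Meets T s 8 fun s' => s'.repr = Function.update s.repr r e ∧
      (s'.reg 4 = [] ∨ ∃ h, AtCall T s' (s.repr r) h ∧ h ≠ [] ∧ ¬ IsAncestor T h e ∧
        (IsAncestor T r (s.repr r) → IsAncestor T r h)) := by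
  obtain ⟨hinv, h0, h1, h4, hne, hi, ha⟩ := hs
  have hinv' := hinv.update hi ha
  refine (meets_instr_seq (.getRepr _ _ _) <| meets_instr_seq (.setRepr _ _ _) <|
    meets_ite (n := 5) (fun hb => (meets_instr (.top _ _) ?_).mono (by omega) fun _ h => h)
      fun hb => ?_).mono (by omega) fun _ h => h
  · exact ⟨by simp [Config.setReg, h0, h1], Or.inl (by simp [Config.setReg, topEdge])⟩
  · have hf : s.repr r ≠ [] := by
      intro h
      apply hb
      simpa [Test.Holds, Config.setReg, h1, topEdge] using h
    obtain ⟨g, hg⟩ := exists_isLCA hi (hinv.isInternal r)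
    refine (meets_instr_seq (.lca _ _ _ _ g (by simpa [Config.setReg, h0, h1] using hg)) <|
      meets_ite (n := 2)
        (fun hb => (meets_instr (.top _ _) ?_).mono (by omega) fun _ h => h)
        fun hb => ?_).mono (by omega) fun _ h => h
    · exact ⟨by simp [Config.setReg, h0, h1], Or.inl (by simp [Config.setReg, topEdge])⟩
    · have hgf : g ≠ s.repr r := by
        intro h
        apply hb
        simpa [Test.Holds, Config.setReg, h1] using h
      obtain ⟨k, hk, hkf⟩ := hg.2.1.exists_child hgf
      refine (meets_instr_seq (.toward _ _ _ _ k (by simpa [Config.setReg] using hk)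
        (by simpa [Config.setReg, h1] using hkf)) <| meets_instr (.move _ _ _) ?_).mono (by omega)
          fun _ h => h
      refine ⟨by simp [Config.setReg, h0, h1], Or.inr ⟨k, ⟨?_, ?_, ?_, ?_, hf,
        hinv.isInternal r, hkf⟩, hk.ne_nil, hg.not_isAncestor hk hkf, fun hr =>
          (hg.2.2 r ha hr).trans hk.isAncestor⟩⟩
      · simpa [Config.setReg, h0, h1] using hinv'
      · simp [Config.setReg, h1]
      · simp [Config.setReg]
      · simpa [Config.setReg] using h4

/-- The loop of `reprupd`, from the first call with a long second argument on. -/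
theorem reprupd_loop_long {T : List σ} {E : Finset (List σ)} (hE : ∀ e, IsInternal T e → e ∈ E)
    {s : Config σ} {e r : List σ} (hs : AtCall T s e r) (hr : 2 ≤ r.length) :
    ∃ s' n, Prog.Exec T (.whileNot (.isTop 4) (reprupdCall σ)) s s' n ∧ ReprInv T s'.repr ∧
      (n : ℝ) ≤ 9 * (1 + reprPot E s.repr - reprPot E s'.repr + Real.logb 2 (slack E r e) / 2 +
        Real.logb 2 (weight E r) + Real.logb 2 E.card) + 1 := by
  induction hw : weight E r using Nat.strong_induction_on generalizing s e r with
  | _ w ih =>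
    subst hw
    obtain ⟨s₁, m, hex, hm, hrepr, hcase⟩ := reprupdCall_meets hs
    have hrE : r ∈ E := hE r (hs.isAncestor.isInternal hs.isInternal)
    have hre : r <:+ e := hs.isAncestor.suffix hr
    have hpot := reprPot_update s.repr e hrE hr
    rw [← hrepr, pathPot_of_ne_nil E r hs.ne_nil] at hpot
    have hm' : (m : ℝ) ≤ 8 := by exact_mod_cast hm
    have hb : ¬ (Test.isTop 4).Holds s := hs.reg_four
    rcases hcase with h4 | ⟨h, hs₁, -, hhe, hrh⟩
    · refine ⟨s₁, m + 1 + 1, .whileStep hb hex (.whileDone h4), ?_, ?_⟩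
      · rw [hrepr]
        exact hs.inv.update hs.isInternal hs.isAncestor
      -- The last call may raise the potential without releasing any; the summand log |E| of the
      -- bound is kept for this call.
      · have h1 := pathPot_nonneg E r (s.repr r)
        have h2 : Real.logb 2 (slack E r e) ≤ Real.logb 2 E.card :=
          logb_two_mono ((slack_le_weight r e).trans (weight_le_card r))
        have h3 := logb_two_nonneg (slack E r e)
        have h4 := logb_two_nonneg (weight E r)
        push_cast
        linarith
    · have hf := hs₁.ne_nil
      have hrf : r <:+ s.repr r := hs.inv.suffix r hr hf
      have hrh' := hrh ((hs₁.isInternal.isAncestor_iff hr).2 hrf)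
      have hl : 2 ≤ h.length := hr.trans hrh'.length_le
      have hhE : h ∈ E := hE h (hs₁.isAncestor.isInternal hs₁.isInternal)
      have hhe' : ¬ h <:+ e := fun hh => hhe ((hs.isInternal.isAncestor_iff hl).2 hh)
      have hrh'' := hrh'.suffix hr
      have hlt : weight E h < weight E r :=
        weight_lt hrE hrh'' (by rintro rfl; exact hhe' hre)
      obtain ⟨s', n, hex', hinv', hn⟩ := ih _ hlt hs₁ hl rfl
      refine ⟨s', m + n + 1, .whileStep hb hex hex', hinv', ?_⟩
      -- The carried edge brings half of its log slack as credit. Replacing `f` by `e` at `r` uses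
      -- the credit of `e`, and the released potential of `f` leaves half a log slack at `h` for
      -- `f`.
      have key := logb_slack_add_le hrE hhE hrh'' (hs₁.isAncestor.suffix hl) hre hhe'
      rw [pathPot_of_ne_nil E r hf] at hpot
      push_cast
      linarith

/-! Calls whose second argument has at most one symbol. -/

variable [Fintype σ]

theorem numMoved_update_le {T : List σ} (ρ : Edge σ → Edge σ) {r e : List σ}
    (h : IsAncestor T r e) : numMoved T (Function.update ρ r e) ≤ numMoved T ρ := by
  classical
  refine Finset.card_le_card fun c hc => ?_
  simp only [Finset.mem_filter, Finset.mem_univ, true_and] at hc ⊢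
  by_cases hr : [c] = r
  · rw [hr, Function.update_self] at hc
    exact absurd h hc
  · rwa [Function.update_of_ne hr] at hc

theorem numMoved_update_lt {T : List σ} (ρ : Edge σ → Edge σ) {c : σ} {e : List σ}
    (h : IsAncestor T [c] e) (h' : ¬ IsAncestor T [c] (ρ [c])) :
    numMoved T (Function.update ρ [c] e) < numMoved T ρ := by
  classical
  refine Finset.card_lt_card ?_
  rw [Finset.ssubset_iff_of_subset]
  · exact ⟨c, by simpa using h', by simpa using h⟩
  · intro d hd
    simp only [Finset.mem_filter, Finset.mem_univ, true_and] at hd ⊢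
    by_cases hr : [d] = [c]
    · rw [hr, Function.update_self] at hd
      exact absurd h hd
    · rwa [Function.update_of_ne hr] at hd

/-- If repr r lies below `r`, the next argument lies strictly below `r`, and a one-symbol argument
gains depth. Otherwise the call repairs the value at `r`, so `numMoved` drops, which with the factor
|Σ| + 1 outweighs any loss of depth. At the first long argument the remaining calls are paid by
`reprupd_loop_long`, whose extra terms are at most 5/2 log |E|. -/
theorem reprupd_loop {T : List σ} {E : Finset (List σ)} (hE : ∀ e, IsInternal T e → e ∈ E)
    {s : Config σ} {e r : List σ} (hs : AtCall T s e r) (hr : r.length ≤ 1) {μ : ℕ}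
    (hμ : numMoved T s.repr * (Fintype.card σ + 1) + (Fintype.card σ - depth T r) ≤ μ) :
    ∃ s' n, Prog.Exec T (.whileNot (.isTop 4) (reprupdCall σ)) s s' n ∧ ReprInv T s'.repr ∧
      (n : ℝ) ≤ 9 * (2 + μ + reprPot E s.repr - reprPot E s'.repr +
        3 * Real.logb 2 E.card) + 1 := by
  induction μ using Nat.strong_induction_on generalizing s e r with
  | _ μ ih =>
    obtain ⟨s₁, m, hex, hm, hrepr, hcase⟩ := reprupdCall_meets hs
    have hpot := reprPot_update_short E s.repr e (r := r) (by omega)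
    rw [← hrepr] at hpot
    have hm' : (m : ℝ) ≤ 8 := by exact_mod_cast hm
    have hL := logb_two_nonneg E.card
    have hμ0 : (0 : ℝ) ≤ μ := Nat.cast_nonneg μ
    have hb : ¬ (Test.isTop 4).Holds s := hs.reg_four
    rcases hcase with h4 | ⟨h, hs₁, hne, hhe, hrh⟩
    · refine ⟨s₁, m + 1 + 1, .whileStep hb hex (.whileDone h4), ?_, ?_⟩
      · rw [hrepr]
        exact hs.inv.update hs.isInternal hs.isAncestor
      · push_cast
        linarith
    · by_cases hl : 2 ≤ h.length
      · obtain ⟨s', n, hex', hinv', hn⟩ := reprupd_loop_long hE hs₁ hl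
        refine ⟨s', m + n + 1, .whileStep hb hex hex', hinv', ?_⟩
        have h1 : Real.logb 2 (slack E h (s.repr r)) ≤ Real.logb 2 E.card :=
          logb_two_mono ((slack_le_weight _ _).trans (weight_le_card _))
        have h2 : Real.logb 2 (weight E h) ≤ Real.logb 2 E.card := logb_two_mono (weight_le_card _)
        push_cast
        linarith
      · obtain ⟨c, rfl⟩ : ∃ c, h = [c] := by
          have := List.length_pos_iff.2 hne
          exact List.length_eq_one_iff.1 (by omega)
        have hdc := depth_le T [c]
        have hdr := depth_le T r
        have hlt : numMoved T s₁.repr * (Fintype.card σ + 1) +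
            (Fintype.card σ - depth T [c]) < μ := by
          refine lt_of_lt_of_le ?_ hμ
          by_cases hrf : IsAncestor T r (s.repr r)
          · have h1 := depth_lt (hrh hrf) (by rintro rfl; exact hhe hs.isAncestor)
            have h2 := numMoved_update_le s.repr hs.isAncestor
            rw [← hrepr] at h2
            have h3 := Nat.mul_le_mul_right (Fintype.card σ + 1) h2
            omega
          · obtain ⟨d, rfl⟩ : ∃ d, r = [d] := by
              have : r ≠ [] := by
                rintro rfl
                exact hrf (hs.inv.isInternal []).isAncestor_nil
              have := List.length_pos_iff.2 this
              exact List.length_eq_one_iff.1 (by omega)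
            have h2 := numMoved_update_lt s.repr hs.isAncestor hrf
            rw [← hrepr] at h2
            have h3 := Nat.mul_le_mul_right (Fintype.card σ + 1) h2
            rw [Nat.succ_mul] at h3
            omega
        obtain ⟨s', n, hex', hinv', hn⟩ := ih _ hlt hs₁ (by simp) le_rfl
        refine ⟨s', m + n + 1, .whileStep hb hex hex', hinv', ?_⟩
        have : ((numMoved T s₁.repr * (Fintype.card σ + 1) +
            (Fintype.card σ - depth T [c]) : ℕ) : ℝ) + 1 ≤ μ := by exact_mod_cast hlt
        push_cast at this hn ⊢
        linarith

theorem reprupd_exec {T : List σ} {E : Finset (List σ)} (hE : ∀ e, IsInternal T e → e ∈ E)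
    {s : Config σ} (hs : ReprInv T s.repr) (hi : IsInternal T (s.reg 0)) :
    ∃ s' n, Prog.Exec T (reprupd σ) s s' n ∧ ReprInv T s'.repr ∧
      (n : ℝ) + 9 * reprPot E s'.repr ≤ 9 * reprPot E s.repr +
        (9 * (3 + (Fintype.card σ + 1) ^ 2 + 3 * Real.logb 2 E.card)) := by
  have hL := logb_two_nonneg E.card
  by_cases h0 : s.reg 0 = []
  · refine ⟨s, 2, .iteTrue h0 (.skip s), hs, ?_⟩
    push_cast
    have : (0 : ℝ) ≤ ((Fintype.card σ : ℝ) + 1) ^ 2 := by positivity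
    linarith
  · have hat : AtCall T ((s.setReg 1 topEdge).setReg 4 ((s.setReg 1 topEdge).reg 0))
        (s.reg 0) [] :=
      ⟨hs, by simp [Config.setReg], by simp [Config.setReg, topEdge],
        by simpa [Config.setReg] using h0, h0, hi, hi.isAncestor_nil⟩
    obtain ⟨s', n, hex, hinv, hn⟩ := reprupd_loop hE hat (by simp)
      -- With k = |Σ|, the measure is at most k (k + 1) + k.
      (μ := (Fintype.card σ + 1) ^ 2) (by
        have h1 := numMoved_le T s.repr
        have h2 := Nat.mul_le_mul_right (Fintype.card σ + 1) h1
        simp only [Config.setReg]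
        nlinarith [Nat.sub_le (Fintype.card σ) (depth T [])])
    refine ⟨s', _, .iteFalse h0 (.seq (.instr (.top _ _)) (.seq (.instr (.move _ _ _)) hex)),
      hinv, ?_⟩
    have h1 : reprPot E ((s.setReg 1 topEdge).setReg 4 ((s.setReg 1 topEdge).reg 0)).repr =
      reprPot E s.repr := rfl
    rw [h1] at hn
    push_cast at hn ⊢
    linarith

theorem reprupd_total_time (σ : Type*) [Fintype σ] [DecidableEq σ] :
    ∃ C : ℝ, ∀ (T : List σ) (u : ℕ → Option (Edge σ)), IsSchedule T u →
      ∃ (S : ℕ → Config σ) (n : ℕ → ℕ), IsRun (reprupd σ) T u S n ∧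
        (2 ≤ T.length → ((∑ i ∈ Finset.range T.length, n i : ℕ) : ℝ) ≤
          C * (T.length * Real.log T.length)) := by
  -- A call and its loop test take at most 8 + 1 steps. The logarithm has the coefficient 27 = 9 ·
  -- 3, doubled by the passage from |E| to N.
  refine ⟨(9 * (3 + (Fintype.card σ + 1) ^ 2) + 2 * 27) / Real.log 2, fun T u hu => ?_⟩
  obtain ⟨S, n, hrun, -, hn⟩ := exists_isRun (P := reprupd σ) (T := T) (u := u)
    (fun i s => ReprInv (T.take i) s.repr) (fun _ s => 9 * reprPot (edges T) s.repr)
    (9 * (3 + (Fintype.card σ + 1) ^ 2 + 3 * Real.logb 2 (edges T).card))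
    ⟨fun _ => isInternal_nil _, fun _ _ h => absurd rfl h⟩
    (fun _ s => mul_nonneg (by norm_num) (reprPot_nonneg _ _))
    (fun i hi s hs => by
      have := reprupd_exec (T := T.take (i + 1)) (E := edges T)
        (s := s.setReg 0 ((u (i + 1)).getD topEdge))
        (fun e he => mem_edges.2 (he.mono (List.take_prefix _ _).isInfix))
        (hs.mono (List.IsPrefix.isInfix (List.take_prefix_take_left (by omega))))
        (by simpa [Config.setReg] using hu.isInternal hi)
      exact this)
  refine ⟨S, n, hrun, fun hT => ?_⟩
  have h0 : reprPot (edges T) (Config.init σ).repr = 0 :=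
    Finset.sum_eq_zero fun r _ => by simp [pathPot, Config.init, topEdge]
  rw [h0] at hn
  have h1 := mul_logb_card_edges_le hT (9 * (3 + (Fintype.card σ + 1) ^ 2)) 27 (by positivity)
    (by norm_num)
  refine (hn.trans (le_of_eq ?_)).trans h1
  ring

end SufTree

/-! ### Most recent updates on long edges and the heavy-child potential. -/

namespace SufTree

variable {σ : Type*}

/-! ### Most recent updates below long edges -/

/-- The structure of a function that maps a string to the most recently updated string of which it
is a suffix, or to the empty string if there is none. -/
structure IsLast (m : Edge σ → Edge σ) : Prop where
  suffix : ∀ g, m g ≠ [] → g <:+ m g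
  eq_of_suffix : ∀ r g, r <:+ g → g <:+ m r → m g = m r
  eq_nil : ∀ r g, r <:+ g → m r = [] → m g = []

/-- The values `ρ` determine the values `m` at long edges, by passing to the suffixes. -/
structure Covers (m ρ : Edge σ → Edge σ) : Prop where
  of_two : ∀ g, g.length = 2 → ρ g = m g
  of_three : ∀ g, 3 ≤ g.length → m g = m g.tail ∨ ρ g = m g
  eq_nil : ∀ g, 2 ≤ g.length → m g = [] → ρ g = []

theorem Covers.congr {m ρ ρ' : Edge σ → Edge σ} (h : Covers m ρ)
    (hρ : ∀ g, 2 ≤ g.length → ρ' g = ρ g) : Covers m ρ' :=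
  ⟨fun g hg => by rw [hρ g hg.ge, h.of_two g hg],
    fun g hg => by rw [hρ g (by omega)]; exact h.of_three g hg,
    fun g hg h0 => by rw [hρ g hg, h.eq_nil g hg h0]⟩

/-- Climb by tails as long as the value is shared with the parent. The climb stops at length two at
the latest, where the stored value is exact. -/
theorem Covers.exists_suffix {m ρ : Edge σ → Edge σ} (h : Covers m ρ) {g : Edge σ}
    (hg : 2 ≤ g.length) : ∃ a, a <:+ g ∧ 2 ≤ a.length ∧ ρ a = m g := by
  induction g with
  | nil => simp at hg
  | cons c g ih =>
    rcases hg.eq_or_lt with h2 | h3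
    · exact ⟨_, List.suffix_rfl, hg, h.of_two _ h2.symm⟩
    · rcases h.of_three _ h3 with h4 | h4
      · obtain ⟨a, ha, hl, hρ⟩ := ih (by simpa using h3)
        exact ⟨a, ha.trans (List.suffix_cons c g), hl, by rw [hρ, h4, List.tail_cons]⟩
      · exact ⟨_, List.suffix_rfl, hg, h4⟩

/-! ### The potential of the most recent updates -/

section Pot

variable {E : Finset (List σ)}

/-- The most recent update below `g` lies in a child of `g` that has more than half of the
weight. -/
def Guided (E : Finset (List σ)) (m : Edge σ → Edge σ) (g : Edge σ) : Prop :=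
  ∃ a, a :: g <:+ m g ∧ weight E g < 2 * weight E (a :: g)

open Classical in
/-- The number of edges below which the most recent update does not lie in the heavy part. -/
noncomputable def numUnguided (E : Finset (List σ)) (m : Edge σ → Edge σ) : ℕ :=
  (E.filter fun g => ¬ Guided E m g).card

theorem numUnguided_le {m m' : Edge σ → Edge σ} (h : ∀ g, Guided E m g → Guided E m' g) :
    numUnguided E m' ≤ numUnguided E m := by
  classical
  refine Finset.card_le_card fun g hg => ?_
  rw [Finset.mem_filter] at hg ⊢
  exact ⟨hg.1, fun h' => hg.2 (h g h')⟩

theorem numUnguided_le_succ {m m' : Edge σ → Edge σ} {x : Edge σ}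
    (h : ∀ g ≠ x, Guided E m g → Guided E m' g) : numUnguided E m' ≤ numUnguided E m + 1 := by
  classical
  refine le_trans (Finset.card_le_card (t := insert x (E.filter fun g => ¬ Guided E m g)) ?_)
    (Finset.card_insert_le _ _)
  intro g hg
  rw [Finset.mem_filter] at hg
  rw [Finset.mem_insert, Finset.mem_filter]
  by_cases hx : g = x
  · exact Or.inl hx
  · exact Or.inr ⟨hg.1, fun h' => hg.2 (h g hx h')⟩

theorem numUnguided_lt {m m' : Edge σ → Edge σ} {x : Edge σ} (hx : x ∈ E)
    (h : ∀ g ≠ x, Guided E m g → Guided E m' g) (h1 : ¬ Guided E m x) (h2 : Guided E m' x) :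
    numUnguided E m' + 1 ≤ numUnguided E m := by
  classical
  refine Finset.card_lt_card ?_
  rw [Finset.ssubset_iff_of_subset]
  · refine ⟨x, Finset.mem_filter.2 ⟨hx, h1⟩, fun h' => ?_⟩
    exact (Finset.mem_filter.1 h').2 h2
  · intro g hg
    rw [Finset.mem_filter] at hg ⊢
    refine ⟨hg.1, fun h' => hg.2 ?_⟩
    by_cases hgx : g = x
    · rwa [hgx]
    · exact h g hgx h'

end Pot

/-! ### Rerouting along a path -/

variable [DecidableEq σ]

/-- The values after `e` has been entered at its suffixes shorter than `n`. -/
def reroute (m : Edge σ → Edge σ) (e : Edge σ) (n : ℕ) (g : Edge σ) : Edge σ :=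
  if g <:+ e ∧ g.length < n then e else m g

section

variable {m : Edge σ → Edge σ} {e : Edge σ} {n : ℕ} {g : Edge σ}

theorem reroute_pos (h : g <:+ e) (hn : g.length < n) : reroute m e n g = e := if_pos ⟨h, hn⟩

theorem reroute_of_not_suffix (h : ¬ g <:+ e) : reroute m e n g = m g := if_neg fun h' => h h'.1

theorem reroute_of_le (h : n ≤ g.length) : reroute m e n g = m g :=
  if_neg fun h' => absurd h'.2 (not_lt.2 h)

theorem reroute_full (m : Edge σ → Edge σ) (e : Edge σ) :
    reroute m e (e.length + 1) = fun g => if g <:+ e then e else m g := by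
  funext g
  unfold reroute
  refine if_congr ⟨fun h => h.1, fun h => ⟨h, ?_⟩⟩ rfl rfl
  have := h.length_le
  omega

theorem IsLast.reroute (hm : IsLast m) (he : e ≠ []) :
    IsLast (reroute m e (e.length + 1)) := by
  rw [reroute_full]
  constructor
  · intro g hg
    split at hg
    · rename_i h; rwa [if_pos h]
    · rename_i h; rw [if_neg h]; exact hm.suffix g hg
  · intro r g hrg hg
    split at hg
    · rename_i h; rw [if_pos h, if_pos hg]
    · rename_i h
      rw [if_neg h, if_neg fun h' => h (hrg.trans h')]
      exact hm.eq_of_suffix r g hrg hg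
  · intro r g hrg hr
    split at hr
    · exact absurd hr he
    · rename_i h
      rw [if_neg fun h' => h (hrg.trans h')]
      exact hm.eq_nil r g hrg hr

/-- Entering a string at its suffixes with at most one symbol does not affect long edges. -/
theorem Covers.reroute_two {ρ : Edge σ → Edge σ} (h : Covers m ρ) (e : Edge σ) :
    Covers (SufTree.reroute m e 2) ρ := by
  constructor
  · intro g hg
    rw [reroute_of_le (by omega)]
    exact h.of_two g hg
  · intro g hg
    rw [reroute_of_le (by omega), reroute_of_le (by rw [List.length_tail]; omega)]
    exact h.of_three g hg
  · intro g hg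
    rw [reroute_of_le (by omega)]
    exact h.eq_nil g hg

end

section Round

variable {m ρ ρ' : Edge σ → Edge σ} {e r g : Edge σ}

/-- One round of the search for `e`: the values on the path from `r` to `m r` are replaced up to
the point `g` where the path to `e` leaves it. -/
theorem Covers.round (hm : IsLast m) (he : e ≠ []) (hr : 2 ≤ r.length)
    (hc : Covers (reroute m e r.length) ρ)
    (hre : r <:+ e) (hrg : r <:+ g) (hge : g <:+ e) (hgf : g <:+ m r) (hf : m r ≠ [])
    (hmax : ∀ c, c <:+ e → c <:+ m r → c.length ≤ g.length) (h1 : ρ' r = e)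
    (h2 : ∀ x, x <:+ m r → x.length = g.length + 1 → ρ' x = m r)
    (h3 : ∀ x, x ≠ r → ¬ (x <:+ m r ∧ x.length = g.length + 1) → ρ' x = ρ x) :
    Covers (reroute m e (g.length + 1)) ρ' := by
  have hlrg := hrg.length_le
  constructor
  · intro x hx
    by_cases hxr : x = r
    · rw [hxr, h1, reroute_pos hre (by omega)]
    · rw [h3 x hxr (by omega), hc.of_two x hx]
      by_cases hxe : x <:+ e
      · by_cases hl : x.length < r.length
        · rw [reroute_pos hxe hl, reroute_pos hxe (by omega)]
        · refine absurd ?_ hxr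
          exact (List.suffix_of_suffix_length_le hxe hre (by omega)).eq_of_length (by omega)
      · rw [reroute_of_not_suffix hxe, reroute_of_not_suffix hxe]
  · intro x hx
    have hlt := List.length_tail (l := x)
    by_cases hxe : x <:+ e ∧ x.length < g.length + 1
    · left
      rw [reroute_pos hxe.1 hxe.2,
        reroute_pos ((List.tail_suffix x).trans hxe.1) (by omega)]
    · have hx1 : reroute m e (g.length + 1) x = m x := if_neg hxe
      have hxr : x ≠ r := by rintro rfl; exact hxe ⟨hre, by omega⟩
      have hx2 : reroute m e r.length x = m x := if_neg fun h => hxe ⟨h.1, by omega⟩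
      rw [hx1]
      -- Off the path to `e` the round writes only at the child of `g` towards `m r`, and what it
      -- writes is the most recent update there.
      have hρ : ρ x = m x → ρ' x = m x := by
        intro h
        by_cases hxf : x <:+ m r ∧ x.length = g.length + 1
        · rw [h2 x hxf.1 hxf.2, hm.eq_of_suffix r x ?_ hxf.1]
          exact List.suffix_of_suffix_length_le (hrg.trans hgf) hxf.1 (by omega)
        · rw [h3 x hxr hxf, h]
      have hcx := hc.of_three x hx
      rw [hx2] at hcx
      by_cases hv : x.tail <:+ e ∧ x.tail.length < g.length + 1
      · rw [reroute_pos hv.1 hv.2]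
        by_cases hvr : x.tail.length < r.length
        · rw [reroute_pos hv.1 hvr] at hcx
          exact hcx.imp id hρ
        -- The parent of `x` lies between `r` and `g`, and its value changes from `m r` to `e`. If
        -- `x` shared the old value, it lies on the path to `m r` but not on that to `e`, so it is
        -- the child of `g` that has just received `m r`.
        · rw [reroute_of_le (by omega)] at hcx
          right
          have hrv : r <:+ x.tail := List.suffix_of_suffix_length_le hre hv.1 (by omega)
          have hvg : x.tail <:+ g := List.suffix_of_suffix_length_le hv.1 hge (by omega)
          have hmv : m x.tail = m r := hm.eq_of_suffix r _ hrv (hvg.trans hgf)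
          rcases hcx with hcx | hcx
          · rw [hmv] at hcx
            have hxf : x <:+ m r := hcx ▸ hm.suffix x (hcx ▸ hf)
            by_cases hxl : x.length = g.length + 1
            · rw [h2 x hxf hxl, hcx]
            · exfalso
              apply hxe
              have : x.length < g.length + 1 := by omega
              exact ⟨(List.suffix_of_suffix_length_le hxf hgf (by omega)).trans hge, this⟩
          · exact hρ hcx
      · rw [show reroute m e (g.length + 1) x.tail = m x.tail from if_neg hv]
        rw [show reroute m e r.length x.tail = m x.tail from
          if_neg fun h => hv ⟨h.1, by omega⟩] at hcx
        exact hcx.imp id hρ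
  · intro x hx hx0
    by_cases hxe : x <:+ e ∧ x.length < g.length + 1
    · rw [reroute_pos hxe.1 hxe.2] at hx0
      exact absurd hx0 he
    · have hx1 : reroute m e (g.length + 1) x = m x := if_neg hxe
      rw [hx1] at hx0
      have hxr : x ≠ r := by rintro rfl; exact hxe ⟨hre, by omega⟩
      rw [h3 x hxr, hc.eq_nil x hx]
      · rw [show reroute m e r.length x = m x from if_neg fun h => hxe ⟨h.1, by omega⟩, hx0]
      · rintro ⟨hxf, hxl⟩
        rw [hm.eq_of_suffix r x (List.suffix_of_suffix_length_le (hrg.trans hgf) hxf (by omega))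
          hxf] at hx0
        exact hf hx0

/-- The next start of the search carries its most recent update. -/
theorem Covers.round_next (hm : IsLast m) (hr : 2 ≤ r.length)
    (hc : Covers (reroute m e r.length) ρ) (hrg : r <:+ g)
    (hgf : g <:+ m r) {k : Edge σ} (hkg : k.tail = g)
    (hkl : k.length = g.length + 1) (hkf : ¬ k <:+ m r) : ρ k = m k := by
  have hlrg := hrg.length_le
  have h := hc.of_three k (by omega)
  rw [reroute_of_le (by omega), hkg, reroute_of_le (by omega), hm.eq_of_suffix r g hrg hgf] at h
  -- Sharing the value of `g` would put `k` on the path to `m r`, unless nothing has been updated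
  -- below `k`; then the stored value is empty too.
  rcases h with h | h
  · by_cases h0 : m k = []
    · rw [h0]
      exact hc.eq_nil k (by omega) (by rw [reroute_of_le (by omega), h0])
    · exact absurd (h ▸ hm.suffix k h0) hkf
  · exact h

/-- The last round, when nothing has been updated below `r`. -/
theorem Covers.finish (hm : IsLast m) (he : e ≠ []) (hr : 2 ≤ r.length)
    (hc : Covers (reroute m e r.length) ρ) (hre : r <:+ e) (hf : m r = []) :
    Covers (reroute m e (e.length + 1)) (Function.update ρ r e) := by
  constructor
  · intro x hx
    by_cases hxr : x = r
    · rw [hxr, Function.update_self, reroute_pos hre (by have := hre.length_le; omega)]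
    · rw [Function.update_of_ne hxr, hc.of_two x hx]
      by_cases hxe : x <:+ e
      · by_cases hl : x.length < r.length
        · rw [reroute_pos hxe hl, reroute_pos hxe (by have := hxe.length_le; omega)]
        · refine absurd ?_ hxr
          exact (List.suffix_of_suffix_length_le hxe hre (by omega)).eq_of_length (by omega)
      · rw [reroute_of_not_suffix hxe, reroute_of_not_suffix hxe]
  · intro x hx
    have hlt := List.length_tail (l := x)
    by_cases hxe : x <:+ e
    · left
      have := hxe.length_le
      rw [reroute_pos hxe (by omega), reroute_pos ((List.tail_suffix x).trans hxe) (by omega)]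
    · have hxr : x ≠ r := by rintro rfl; exact hxe hre
      rw [reroute_of_not_suffix hxe, Function.update_of_ne hxr]
      have hcx := hc.of_three x hx
      rw [reroute_of_not_suffix hxe] at hcx
      by_cases hv : x.tail <:+ e
      · rw [reroute_pos hv (by have := hv.length_le; omega)]
        by_cases hvr : x.tail.length < r.length
        · rwa [reroute_pos hv hvr] at hcx
        -- Nothing has been updated below `r`, so both the stored value and the most recent update
        -- at `x` are empty.
        · right
          have hrx : r <:+ x :=
            (List.suffix_of_suffix_length_le hre hv (by omega)).trans (List.tail_suffix x)
          have hx0 := hm.eq_nil r x hrx hf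
          rw [hx0]
          exact hc.eq_nil x (by omega) (by rw [reroute_of_not_suffix hxe, hx0])
      · rw [reroute_of_not_suffix hv] at hcx ⊢
        exact hcx
  · intro x hx hx0
    by_cases hxe : x <:+ e
    · rw [reroute_pos hxe (by have := hxe.length_le; omega)] at hx0
      exact absurd hx0 he
    · rw [reroute_of_not_suffix hxe] at hx0
      rw [Function.update_of_ne (by rintro rfl; exact hxe hre)]
      exact hc.eq_nil x hx (by rw [reroute_of_not_suffix hxe, hx0])

end Round

/-! ### The amortized cost of a round -/

section Cost

variable {E : Finset (List σ)}
variable {m : Edge σ → Edge σ} {e r g : Edge σ}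

/-- Between `r` and `g` the value changes from `m r` to `e`, but above `g` both lie in the same
child. Only `g` itself can cease to be guided. -/
theorem guided_round (hm : IsLast m) (hre : r <:+ e) (hrg : r <:+ g) (hge : g <:+ e)
    (hgf : g <:+ m r) : ∀ x ≠ g, Guided E (reroute m e r.length) x →
      Guided E (reroute m e (g.length + 1)) x := by
  rintro x hxg ⟨a, ha, hw⟩
  have hlrg := hrg.length_le
  refine ⟨a, ?_, hw⟩
  by_cases hxe : x <:+ e ∧ x.length < r.length
  · rw [reroute_pos hxe.1 hxe.2] at ha
    rwa [reroute_pos hxe.1 (by omega)]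
  · rw [show reroute m e r.length x = m x from if_neg hxe] at ha
    by_cases hxe' : x <:+ e ∧ x.length < g.length + 1
    · rw [reroute_pos hxe'.1 hxe'.2]
      have hxr : r.length ≤ x.length := by
        by_contra hlt
        exact hxe ⟨hxe'.1, by omega⟩
      have hxg' : x <:+ g := List.suffix_of_suffix_length_le hxe'.1 hge (by omega)
      have hxl : x.length < g.length := by
        by_contra hlt
        exact hxg (hxg'.eq_of_length_le (by omega))
      rw [hm.eq_of_suffix r x (List.suffix_of_suffix_length_le hre hxe'.1 hxr)
        (hxg'.trans hgf)] at ha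
      exact (List.suffix_of_suffix_length_le ha hgf (by simpa using hxl)).trans hge
    · rwa [show reroute m e (g.length + 1) x = m x from if_neg hxe']

/-- The values that change were empty, and an edge with an empty value is not guided. -/
theorem guided_finish (hm : IsLast m) (hre : r <:+ e) (hf : m r = []) :
    ∀ x, Guided E (reroute m e r.length) x → Guided E (reroute m e (e.length + 1)) x := by
  rintro x ⟨a, ha, hw⟩
  refine ⟨a, ?_, hw⟩
  by_cases hxe : x <:+ e
  · rw [reroute_pos hxe (by have := hxe.length_le; omega)]
    by_cases hl : x.length < r.length
    · rwa [reroute_pos hxe hl] at ha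
    · rw [reroute_of_le (by omega), hm.eq_nil r x
        (List.suffix_of_suffix_length_le hre hxe (by omega)) hf] at ha
      simp at ha
  · rw [reroute_of_not_suffix hxe] at ha ⊢
    exact ha

/-- The amortized cost of a round that continues at `k`. -/
theorem numUnguided_round (hm : IsLast m) (hre : r <:+ e) (hrg : r <:+ g)
    (hge : g <:+ e) (hgf : g <:+ m r) (hgE : g ∈ E) {k : Edge σ} (hke : k <:+ e)
    (hkE : k ∈ E) (hkg : k.tail = g) (hkl : k.length = g.length + 1) (hkf : ¬ k <:+ m r) :
    numUnguided E (reroute m e k.length) + 1 + 2 * Nat.log 2 (weight E k) ≤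
      numUnguided E (reroute m e r.length) + 2 * Nat.log 2 (weight E r) := by
  have hstep := guided_round (E := E) hm hre hrg hge hgf
  obtain ⟨a, rfl⟩ : ∃ a, k = a :: g := by
    cases k with
    | nil => simp at hkl
    | cons a k => exact ⟨a, by simpa using hkg⟩
  rw [hkl]
  have hlrg := hrg.length_le
  have hwg : weight E g ≤ weight E r := weight_anti hrg
  have hwk : weight E (a :: g) ≤ weight E g := weight_anti (List.suffix_cons a g)
  have hpos := weight_pos hkE
  -- If `k` is heavy, `g` becomes guided and no logarithm grows. If `k` is light, the logarithm
  -- drops by one, and its factor 2 covers both the round and a possible loss of guidance at `g`.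
  by_cases hw : weight E g < 2 * weight E (a :: g)
  · have h2 : Guided E (reroute m e (g.length + 1)) g :=
      ⟨a, by rwa [reroute_pos hge (by omega)], hw⟩
    have h1 : ¬ Guided E (reroute m e r.length) g := by
      rintro ⟨b, hb, hwb⟩
      rw [reroute_of_le hlrg, hm.eq_of_suffix r g hrg hgf] at hb
      have hne : a ≠ b := by rintro rfl; exact hkf hb
      -- Two different children of `g` cannot both have more than half of its weight.
      have := weight_add_le (E := E) (List.suffix_cons a g) (List.suffix_cons b g)
        (fun h => hne (by simpa using (h.eq_of_length (by simp))))
        (fun h => hne (by simpa using (h.eq_of_length (by simp)).symm))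
      omega
    have := numUnguided_lt hgE hstep h1 h2
    have := Nat.log_mono_right (b := 2) (hwk.trans hwg)
    omega
  · have h1 := numUnguided_le_succ hstep
    have h2 : Nat.log 2 (weight E (a :: g)) + 1 ≤ Nat.log 2 (weight E r) := by
      rw [← Nat.log_mul_base (by norm_num) (by omega)]
      exact Nat.log_mono_right (by omega)
    omega

/-- At most one value changes, that of the suffix of `e` of length `n`. -/
theorem numUnguided_reroute_succ (m : Edge σ → Edge σ) (e : Edge σ) (n : ℕ) :
    numUnguided E (reroute m e (n + 1)) ≤ numUnguided E (reroute m e n) + 1 := by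
  refine numUnguided_le_succ (x := e.drop (e.length - n)) fun g hg h => ?_
  have : reroute m e (n + 1) g = reroute m e n g := by
    by_cases hge : g <:+ e
    · have hl : g.length ≠ n := by
        rintro rfl
        exact hg (List.suffix_iff_eq_drop.1 hge)
      unfold reroute
      refine if_congr ⟨fun h => ⟨h.1, ?_⟩, fun h => ⟨h.1, ?_⟩⟩ rfl rfl <;> omega
    · rw [reroute_of_not_suffix hge, reroute_of_not_suffix hge]
  unfold Guided
  rwa [this]

theorem numUnguided_reroute_two (m : Edge σ → Edge σ) (e : Edge σ) :
    numUnguided E (reroute m e 2) ≤ numUnguided E m + 2 := by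
  have h0 : reroute m e 0 = m := by
    funext g
    exact reroute_of_le (Nat.zero_le _)
  have h1 := numUnguided_reroute_succ (E := E) m e 0
  have h2 := numUnguided_reroute_succ (E := E) m e 1
  rw [h0] at h1
  exact h2.trans (Nat.add_le_add_right h1 1)

end Cost

end SufTree

/-! ### Entering an update at the long edges. -/

namespace SufTree

variable {σ : Type*}

/-! ### Searching for the updated edge along the most recent updates -/

/-- One round of the search for the edge in register `0`, starting at the edge in register `1`. -/
def searchRound (σ : Type*) : Prog σ :=
  .seq (.instr (.getRepr 2 1)) <|
  .seq (.instr (.setRepr 1 0)) <|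
  .ite (.isTop 2) (.instr (.top 4)) <|
  .seq (.instr (.lca 3 0 2)) <|
  .seq (.ite (.eq 3 2) .skip (.seq (.instr (.toward 5 3 2)) (.instr (.setRepr 5 2)))) <|
  .ite (.eq 3 0) (.instr (.top 4)) (.instr (.toward 1 3 0))

/-- Enter the edge in register `0` at its ancestors, from the edge in register `1` on. -/
def search (σ : Type*) : Prog σ :=
  .seq (.instr (.move 4 0)) (.whileNot (.isTop 4) (searchRound σ))

/-- What a search leaves unchanged. -/
structure SearchKeeps (s s' : Config σ) : Prop where
  field : s'.field = s.field
  reg : ∀ j, j = 0 ∨ 6 ≤ j → s'.reg j = s.reg j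
  repr : ∀ g, g.length < 2 → s'.repr g = s.repr g

theorem SearchKeeps.trans {s s' s'' : Config σ} (h : SearchKeeps s s') (h' : SearchKeeps s' s'') :
    SearchKeeps s s'' :=
  ⟨h'.field.trans h.field, fun j hj => (h'.reg j hj).trans (h.reg j hj),
    fun g hg => (h'.repr g hg).trans (h.repr g hg)⟩

variable [DecidableEq σ]

/-- The state before a round of the search for `e` that starts at `r`. -/
structure AtSearch (T : List σ) (m : Edge σ → Edge σ) (e r : Edge σ) (s : Config σ) : Prop where
  isLast : IsLast m
  isInternal_last : ∀ g, IsInternal T (m g)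
  isInternal : IsInternal T e
  ne_nil : e ≠ []
  two_le : 2 ≤ r.length
  suffix : r <:+ e
  covers : Covers (reroute m e r.length) s.repr
  repr_eq : s.repr r = m r
  reg_zero : s.reg 0 = e
  reg_one : s.reg 1 = r
  reg_four : s.reg 4 ≠ []

/-- Since `r` is long and lies above both `e` and `m r`, their lowest common ancestor is their
longest common suffix. The value at `r` is exact on entry, and `Covers.round_next` gives the same at
the next start. -/
theorem searchRound_meets {T : List σ} {E : Finset (List σ)} (hE : ∀ e, IsInternal T e → e ∈ E)
    {m : Edge σ → Edge σ} {e r : Edge σ} {s : Config σ} (hs : AtSearch T m e r s) :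
    (searchRound σ).Meets T s 11 fun s' => SearchKeeps s s' ∧
      ((s'.reg 4 = [] ∧ Covers (reroute m e (e.length + 1)) s'.repr ∧
        numUnguided E (reroute m e (e.length + 1)) ≤ numUnguided E (reroute m e r.length) + 1) ∨
      ∃ k, AtSearch T m e k s' ∧ r.length < k.length ∧
        numUnguided E (reroute m e k.length) + 1 + 2 * Nat.log 2 (weight E k) ≤
          numUnguided E (reroute m e r.length) + 2 * Nat.log 2 (weight E r)) := by
  obtain ⟨hm, hmi, hi, hne, hr, hre, hc, hρ, h0, h1, h4⟩ := hs
  refine (meets_instr_seq (.getRepr _ _ _) <| meets_instr_seq (.setRepr _ _ _) <|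
    meets_ite (n := 8) (fun hb => (meets_instr (.top _ _) ?_).mono (by omega) fun _ h => h)
      fun hb => ?_).mono (by omega) fun _ h => h
  · have hf : m r = [] := by
      rw [← hρ]
      simpa [Test.Holds, Config.setReg, h1, topEdge] using hb
    refine ⟨⟨rfl, ?_, ?_⟩, Or.inl ⟨by simp [Config.setReg, topEdge], ?_, ?_⟩⟩
    · intro j hj
      simp only [Config.setReg]
      rw [Function.update_of_ne (by omega), Function.update_of_ne (by omega)]
    · intro g hg
      simp only [Config.setReg]
      rw [Function.update_of_ne]
      rintro rfl
      simp [h1] at hg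
      omega
    · simpa [Config.setReg, h0, h1] using hc.finish hm hne hr hre hf
    · exact (numUnguided_le (guided_finish hm hre hf)).trans (by omega)
  · have hf : m r ≠ [] := by
      intro h
      apply hb
      rw [← hρ] at h
      simpa [Test.Holds, Config.setReg, h1, topEdge] using h
    obtain ⟨g, hg⟩ := exists_isLCA hi (hmi r)
    have hrf : r <:+ m r := hm.suffix r hf
    have hrg' : IsAncestor T r g :=
      hg.2.2 r ((hi.isAncestor_iff hr).2 hre) (((hmi r).isAncestor_iff hr).2 hrf)
    have hrg : r <:+ g := hrg'.suffix hr
    have hgl : 2 ≤ g.length := hr.trans hrg.length_le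
    have hge : g <:+ e := hg.1.suffix hgl
    have hgf : g <:+ m r := hg.2.1.suffix hgl
    have hgi : IsInternal T g := hi.of_suffix hge
    have hmax : ∀ c, c <:+ e → c <:+ m r → c.length ≤ g.length := by
      intro c hce hcf
      by_cases hcl : 2 ≤ c.length
      · exact ((hg.2.2 c ((hi.isAncestor_iff hcl).2 hce)
          (((hmi r).isAncestor_iff hcl).2 hcf)).suffix hcl).length_le
      · omega
    have hchild : ∀ {x f}, IsInternal T f → IsSuf T x g → IsAncestor T x f →
        x <:+ f ∧ x.tail = g ∧ x.length = g.length + 1 := by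
      intro x f hf hx hxf
      have hxl := hgl.trans hx.length_le
      have hxt := (isSuf_of_two_le hx.isInternal hxl).1 hx
      refine ⟨hxf.suffix hxl, hxt.symm, ?_⟩
      rw [hxt, List.length_tail]
      omega
    refine (meets_instr_seq (.lca _ _ _ _ g (by simpa [Config.setReg, h0, h1, hρ] using hg)) <|
      Prog.Meets.seq (m := 3) (n := 2) (R := fun s' => s'.field = s.field ∧
        (∀ j, j ≠ 2 → j ≠ 3 → j ≠ 5 → s'.reg j = s.reg j) ∧ s'.reg 3 = g ∧
        (∀ g, g.length < 2 → s'.repr g = s.repr g) ∧ Covers (reroute m e (g.length + 1)) s'.repr ∧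
        ∀ k, k.tail = g → k.length = g.length + 1 → ¬ k <:+ m r → s'.repr k = m k)
        ?_ ?_).mono (by omega) fun _ h => h
    · have hlrg := hrg.length_le
      have hnext : ∀ k : Edge σ, k.tail = g → k.length = g.length + 1 → ¬ k <:+ m r →
          s.repr k = m k := fun k hkg hkl hkf => hc.round_next hm hr hrg hgf hkg hkl hkf
      refine meets_ite (n := 2)
        (fun hb => (meets_skip ?_).mono (by omega) fun _ h => h) fun hb => ?_
      · have hgf' : g = m r := by
          rw [← hρ]
          simpa [Test.Holds, Config.setReg, h1] using hb
        refine ⟨rfl, ?_, by simp [Config.setReg], ?_, ?_, ?_⟩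
        · intro j hj2 hj3 hj5
          simp [Config.setReg, Function.update_of_ne hj2, Function.update_of_ne hj3]
        · intro x hx
          simp only [Config.setReg]
          rw [Function.update_of_ne]
          rintro rfl
          simp [h1] at hx
          omega
        -- The old value is itself an ancestor of `e`, so no branch towards it has to be saved.
        · refine hc.round hm hne hr hre hrg hge hgf hf hmax (by simp [Config.setReg, h0, h1]) ?_ ?_
          · intro x hxf hxl
            have := hxf.length_le
            rw [← hgf'] at this
            omega
          · intro x hxr _
            simp [Config.setReg, h1, Function.update_of_ne hxr]
        · intro k hkg hkl hkf
          rw [← hnext k hkg hkl hkf]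
          have : k ≠ r := by rintro rfl; omega
          simp [Config.setReg, h1, Function.update_of_ne this]
      · have hgf' : g ≠ m r := by
          intro h
          apply hb
          rw [← hρ] at h
          simpa [Test.Holds, Config.setReg, h1] using h
        obtain ⟨x, hx, hxf⟩ := hg.2.1.exists_child hgf'
        obtain ⟨hxf', hxt, hxl⟩ := hchild (hmi r) hx hxf
        refine meets_instr_seq (.toward _ _ _ _ x (by simpa [Config.setReg] using hx)
          (by simpa [Config.setReg, h1, hρ] using hxf)) (meets_instr (.setRepr _ _ _) ?_)
        have hrx : r ≠ x := by rintro rfl; omega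
        refine ⟨rfl, ?_, by simp [Config.setReg], ?_, ?_, ?_⟩
        · intro j hj2 hj3 hj5
          simp [Config.setReg, Function.update_of_ne hj2, Function.update_of_ne hj3,
            Function.update_of_ne hj5]
        · intro y hy
          have hyr : y ≠ r := by rintro rfl; omega
          have hyx : y ≠ x := by rintro rfl; omega
          simp [Config.setReg, h1, Function.update_of_ne hyr, Function.update_of_ne hyx]
        · refine hc.round hm hne hr hre hrg hge hgf hf hmax
            (by simp [Config.setReg, h0, h1, Function.update_of_ne hrx]) ?_ ?_
          · intro y hyf hyl
            have : y = x := (List.suffix_of_suffix_length_le hyf hxf' (by omega)).eq_of_length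
              (by omega)
            subst this
            simp [Config.setReg, h1, hρ]
          · intro y hyr hyf
            have hyx : y ≠ x := by rintro rfl; exact hyf ⟨hxf', hxl⟩
            simp [Config.setReg, h1, Function.update_of_ne hyr, Function.update_of_ne hyx]
        · intro k hkg hkl hkf
          rw [← hnext k hkg hkl hkf]
          have hkr : k ≠ r := by rintro rfl; omega
          have hkx : k ≠ x := by rintro rfl; exact hkf hxf'
          simp [Config.setReg, h1, Function.update_of_ne hkr, Function.update_of_ne hkx]
    · rintro s' ⟨hfield, hreg, hg3, hshort, hcov, hnext⟩
      refine meets_ite (n := 1) (fun hb => meets_instr (.top _ _) ?_) fun hb => ?_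
      · have hge' : g = e := by
          rw [← hg3, ← h0, ← hreg 0 (by omega) (by omega) (by omega)]
          exact hb
        refine ⟨⟨hfield, ?_, hshort⟩, Or.inl ⟨by simp [Config.setReg, topEdge], ?_, ?_⟩⟩
        · intro j hj
          simp only [Config.setReg]
          rw [Function.update_of_ne (by omega), hreg j (by omega) (by omega) (by omega)]
        · rw [← hge']
          subst hge'
          exact hcov
        · have := numUnguided_le_succ (guided_round (E := E) hm hre hrg hge hgf)
          rwa [hge'] at this
      · have h0' : s'.reg 0 = e := by rw [hreg 0 (by omega) (by omega) (by omega), h0]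
        have hge' : g ≠ e := by
          intro h
          apply hb
          show s'.reg 3 = s'.reg 0
          rw [hg3, h0', h]
        obtain ⟨k, hk, hke⟩ := hg.1.exists_child hge'
        obtain ⟨hke', hkt, hkl⟩ := hchild hi hk hke
        have hlrg := hrg.length_le
        have hkf : ¬ k <:+ m r := fun hkf => by
          have := hmax k hke' hkf
          omega
        refine meets_instr (.toward _ _ _ _ k (by rwa [hg3]) (by rwa [h0'])) ?_
        refine ⟨⟨hfield, ?_, hshort⟩, Or.inr ⟨k, ⟨hm, hmi, hi, hne, by omega, hke', ?_, ?_, ?_, ?_,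
          ?_⟩, by omega, ?_⟩⟩
        · intro j hj
          simp only [Config.setReg]
          rw [Function.update_of_ne (by omega), hreg j (by omega) (by omega) (by omega)]
        · rw [hkl]
          exact hcov
        · exact hnext k hkt hkl hkf
        · simp [Config.setReg, h0']
        · simp [Config.setReg]
        · simpa [Config.setReg, hreg 4 (by omega) (by omega) (by omega)] using h4
        · exact numUnguided_round hm hre hrg hge hgf (hE g hgi) hke' (hE k hk.isInternal) hkt hkl hkf

/-- A round with its loop test takes at most 11 + 1 steps, hence the factor 12. The summand 2 covers
the last round: its own cost and one edge that may cease to be guided. -/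
theorem search_loop {T : List σ} {E : Finset (List σ)} (hE : ∀ e, IsInternal T e → e ∈ E)
    {m : Edge σ → Edge σ} {e r : Edge σ} {s : Config σ} (hs : AtSearch T m e r s) :
    ∃ s' n, Prog.Exec T (.whileNot (.isTop 4) (searchRound σ)) s s' n ∧ SearchKeeps s s' ∧
      Covers (reroute m e (e.length + 1)) s'.repr ∧
      n + 12 * numUnguided E (reroute m e (e.length + 1)) ≤
        12 * (numUnguided E (reroute m e r.length) + 2 * Nat.log 2 (weight E r) + 2) + 1 := by
  induction hd : e.length - r.length using Nat.strong_induction_on generalizing s r with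
  | _ d ih =>
    obtain ⟨s₁, j, hex, hj, hk, hcase⟩ := searchRound_meets hE hs
    have hb : ¬ (Test.isTop 4).Holds s := hs.reg_four
    rcases hcase with ⟨h4, hcov, hpot⟩ | ⟨k, hs₁, hlt, hpot⟩
    · exact ⟨s₁, j + 1 + 1, .whileStep hb hex (.whileDone h4), hk, hcov, by omega⟩
    · have := hs₁.suffix.length_le
      obtain ⟨s', n, hex', hk', hcov, hn⟩ := ih _ (by omega) hs₁ rfl
      exact ⟨s', j + n + 1, .whileStep hb hex hex', hk.trans hk', hcov, by omega⟩

theorem search_exec {T : List σ} {E : Finset (List σ)} (hE : ∀ e, IsInternal T e → e ∈ E)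
    {m : Edge σ → Edge σ} {e t : Edge σ} {s : Config σ} (hm : IsLast m)
    (hmi : ∀ g, IsInternal T (m g)) (hi : IsInternal T e) (ht : t.length = 2) (hte : t <:+ e)
    (hc : Covers m s.repr) (h0 : s.reg 0 = e) (h1 : s.reg 1 = t) :
    ∃ s' n, Prog.Exec T (search σ) s s' n ∧ SearchKeeps s s' ∧
      Covers (reroute m e (e.length + 1)) s'.repr ∧
      n + 12 * numUnguided E (reroute m e (e.length + 1)) ≤
        12 * (numUnguided E (reroute m e 2) + 2 * Nat.log 2 E.card + 2) + 2 := by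
  have hne : e ≠ [] := by
    rintro rfl
    rw [List.suffix_nil.1 hte] at ht
    simp at ht
  have hs : AtSearch T m e t (s.setReg 4 (s.reg 0)) :=
    ⟨hm, hmi, hi, hne, ht.ge, hte, ht ▸ hc.reroute_two e, hc.of_two t ht, by simp [Config.setReg, h0],
      by simp [Config.setReg, h1], by simpa [Config.setReg, h0] using hne⟩
  obtain ⟨s', n, hex, hk, hcov, hn⟩ := search_loop hE hs
  have hk0 : SearchKeeps s (s.setReg 4 (s.reg 0)) := by
    refine ⟨rfl, fun j hj => ?_, fun _ _ => rfl⟩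
    simp only [Config.setReg]
    rw [Function.update_of_ne (by omega)]
  refine ⟨s', _, .seq (.instr (.move _ _ _)) hex, hk0.trans hk, hcov, ?_⟩
  have := Nat.log_mono_right (b := 2) (weight_le_card (E := E) t)
  rw [ht] at hn
  omega

end SufTree

/-! ### Locating the last symbols of an edge without access to its string. -/

namespace SufTree

variable {σ : Type*}

/-! ### Loops over a fixed list -/

/-- Execute `f a` for all entries `a` of a list. -/
def forEach {α : Type*} (f : α → Prog σ) : List α → Prog σ
  | [] => .skip
  | a :: l => .seq (f a) (forEach f l)

theorem meets_forEach [DecidableEq σ] {T : List σ} {α : Type*} {f : α → Prog σ} {m : ℕ}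
    {I : List α → Config σ → Prop}
    (h : ∀ a l s, I (a :: l) s → (f a).Meets T s m (I l)) (l : List α) {s : Config σ}
    (hs : I l s) : (forEach f l).Meets T s (m * l.length + 1) (I []) := by
  induction l generalizing s with
  | nil => exact (meets_skip hs).mono (by simp) fun _ h => h
  | cons a l ih =>
    refine ((h a l s hs).seq fun s' hs' => ih hs').mono ?_ fun _ h => h
    rw [List.length_cons, Nat.mul_succ]
    omega

/-! ### Finding the last symbol of the updated edge -/

/-- If the edge in register `1`, a child of the one in register `6`, starts with `a` and has only
one symbol, copy it to register `4`. -/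
def testSymbol (a : σ) : Prog σ :=
  .seq (.instr (.rsuf 7 6 a)) <|
  .ite (.eq 7 1)
    (.seq (.instr (.top 2)) <|
      .seq (.instr (.rsuf 7 2 a)) <|
      .ite (.isTop 7) (.instr (.move 4 1)) (.ite (.eq 7 1) (.instr (.move 4 1)) .skip))
    .skip

/-- What the auxiliary programs on the registers `1` to `9` leave unchanged. -/
structure Keeps (s s' : Config σ) : Prop where
  repr : s'.repr = s.repr
  field : s'.field = s.field
  reg : ∀ j, j = 0 ∨ 10 ≤ j → s'.reg j = s.reg j

theorem Keeps.refl (s : Config σ) : Keeps s s := ⟨rfl, rfl, fun _ _ => rfl⟩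

theorem Keeps.trans {s s' s'' : Config σ} (h : Keeps s s') (h' : Keeps s' s'') : Keeps s s'' :=
  ⟨h'.repr.trans h.repr, h'.field.trans h.field, fun j hj => (h'.reg j hj).trans (h.reg j hj)⟩

theorem Keeps.setReg {s s' : Config σ} (h : Keeps s s') {x : ℕ} (hx : x ≠ 0) (hx' : x < 10)
    (e : Edge σ) : Keeps s (s'.setReg x e) := by
  refine ⟨h.repr, h.field, fun j hj => ?_⟩
  simp only [Config.setReg]
  rw [Function.update_of_ne (by omega), h.reg j hj]

theorem isSuf_nil_iff {T e : List σ} : IsSuf T e [] ↔ ∃ c, e = [c] ∧ IsInternal T [c] ∧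
    IsNode T [c] := by
  constructor
  · intro h
    have hi := h.isInternal
    match e, hi, h.ne_nil with
    | [c], hi, _ =>
      refine ⟨c, rfl, hi, ?_⟩
      by_contra hc
      rw [isSuf_not_node hi hc] at h
      obtain ⟨d, hd, -⟩ := h
      simp at hd
    | a :: b :: e, hi, _ =>
      rw [isSuf_cons_cons hi] at h
      simp at h
  · rintro ⟨c, rfl, hi, hc⟩
    exact (isSuf_node hi hc).2 rfl

/-- A child of a one-symbol edge has one or two symbols; in the second case the first of them is
a node. -/
theorem IsSuf.child_cases {T x : List σ} {c : σ} (h : IsSuf T x [c]) :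
    (∃ a, x = [a] ∧ ¬ IsNode T [a]) ∨ ∃ a, x = [a, c] ∧ IsNode T [a] ∧ IsInternal T [a] := by
  have hi := h.isInternal
  match x, hi, h.ne_nil with
  | [a], hi, _ =>
    refine Or.inl ⟨a, rfl, fun hn => ?_⟩
    rw [isSuf_node hi hn] at h
    simp at h
  | a :: b :: x, hi, _ =>
    rw [isSuf_cons_cons hi] at h
    obtain ⟨rfl, rfl⟩ := List.cons.inj h
    refine Or.inr ⟨a, rfl, ?_⟩
    obtain ⟨hm, W, hW, hp⟩ := isInternal_iff.1 hi
    have hn : IsNode T [a] := by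
      rcases hm with hm | ⟨U, d, hU, hUd, -⟩
      · simp at hm
      · have : U = [a] := by
          have := congrArg List.dropLast hUd
          simpa using this.symm
        rwa [this] at hU
    refine ⟨hn, isInternal_iff.2 ⟨Or.inr ⟨[], a, isNode_nil T, rfl, hn.isInfix⟩, [a], hn,
      List.prefix_rfl⟩⟩

variable [DecidableEq σ]

/-- Suppose that `x` starts with `a`. If `x = [a]`, then `[a]` is not a node, since its parent is
not ⊤, and ⊤ has no child for `a`. If `x = [a, c]`, then `[a]` is a node and is the child of ⊤ for
`a`. One query at ⊤ thus tells the lengths apart. -/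
theorem testSymbol_meets {T : List σ} {s : Config σ} {x : Edge σ} {c : σ} (h1 : s.reg 1 = x)
    (h6 : s.reg 6 = [c]) (hx : IsSuf T x [c]) (a : σ) :
    (testSymbol a).Meets T s 7 fun s' => Keeps s s' ∧ s'.reg 1 = x ∧ s'.reg 6 = [c] ∧
      s'.reg 4 = if x.length = 1 ∧ x.head? = some a then x else s.reg 4 := by
  by_cases hax : x.head? = some a
  · refine (meets_instr_seq (.rsuf s 7 6 a x (by rwa [h6]) hax) <| meets_ite (n := 5)
      (fun _ => ?_) fun hb => absurd (by simp [Test.Holds, Config.setReg, h1]) hb).mono (by omega)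
        fun _ h => h
    refine (meets_instr_seq (n := 4) (.top _ _) ?_).mono (by omega) fun _ h => h
    rcases hx.child_cases with ⟨b, rfl, hb⟩ | ⟨b, rfl, hb, hbi⟩
    · refine (meets_instr_seq (.rsufNone _ _ _ _ ?_) <| meets_ite (n := 1)
        (fun _ => meets_instr (.move _ _ _) ?_) fun hb => absurd ?_ hb).mono (by omega)
          fun _ h => h
      · intro e he hea
        simp only [Config.setReg, Function.update_self, topEdge] at he
        obtain ⟨c', rfl, -, hc'⟩ := isSuf_nil_iff.1 he
        simp only [List.head?_cons, Option.some.injEq] at hax hea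
        subst hax hea
        exact hb hc'
      · refine ⟨((((Keeps.refl s).setReg (by omega) (by omega) _).setReg (by omega) (by omega)
          _).setReg (by omega) (by omega) _).setReg (by omega) (by omega) _, ?_, ?_, ?_⟩
        · simp [Config.setReg, h1]
        · simp [Config.setReg, h6]
        · rw [if_pos ⟨rfl, hax⟩]
          simp [Config.setReg, h1]
      · simp [Test.Holds, Config.setReg]
    · simp only [List.head?_cons, Option.some.injEq] at hax
      subst hax
      refine (meets_instr_seq (.rsuf _ _ _ _ [b] ?_ rfl) <| meets_ite (n := 2)
        (fun hb => absurd hb ?_) fun _ => meets_ite (n := 1) (fun hb => absurd hb ?_) fun _ =>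
          meets_skip ?_).mono (by omega) fun _ h => h
      · simp only [Config.setReg, Function.update_self, topEdge]
        exact (isSuf_node hbi hb).2 rfl
      · simp [Test.Holds, Config.setReg, topEdge]
      · simp [Test.Holds, Config.setReg, h1]
      · refine ⟨(((Keeps.refl s).setReg (by omega) (by omega) _).setReg (by omega) (by omega)
          _).setReg (by omega) (by omega) _, ?_, ?_, ?_⟩
        · simp [Config.setReg, h1]
        · simp [Config.setReg, h6]
        · simp [Config.setReg]
  · have key : ∃ z, (Instr.rsuf 7 6 a).Exec T s (s.setReg 7 z) ∧ z ≠ x := by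
      by_cases h : ∃ e, IsSuf T e [c] ∧ e.head? = some a
      · obtain ⟨e, he, hea⟩ := h
        exact ⟨e, .rsuf s 7 6 a e (by rwa [h6]) hea, by rintro rfl; exact hax hea⟩
      · refine ⟨topEdge, .rsufNone s 7 6 a ?_, hx.ne_nil.symm⟩
        intro e he hea
        rw [h6] at he
        exact h ⟨e, he, hea⟩
    obtain ⟨z, hz, hzx⟩ := key
    refine (meets_instr_seq hz <| meets_ite (n := 1) (fun hb => absurd hb ?_) fun _ =>
      meets_skip ?_).mono (by omega) fun _ h => h
    · simpa [Test.Holds, Config.setReg, h1] using hzx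
    · refine ⟨(Keeps.refl s).setReg (by omega) (by omega) _, ?_, ?_, ?_⟩
      · simp [Config.setReg, h1]
      · simp [Config.setReg, h6]
      · rw [if_neg (fun h => hax h.2)]
        simp [Config.setReg]

variable [Fintype σ]

/-- Copy the edge in register `1`, a child of the one-symbol edge in register `6`, to register `4`
if it has only one symbol, and `⊤` otherwise. -/
noncomputable def testShort (σ : Type*) [Fintype σ] : Prog σ :=
  .seq (.instr (.top 4)) (forEach testSymbol Finset.univ.toList)

/-- The first symbol of `x` cannot be read off, so every symbol is tried; only the right one can
write to register `4`. -/
theorem testShort_meets {T : List σ} {s : Config σ} {x : Edge σ} {c : σ} (h1 : s.reg 1 = x)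
    (h6 : s.reg 6 = [c]) (hx : IsSuf T x [c]) :
    (testShort σ).Meets T s (7 * Fintype.card σ + 2) fun s' => Keeps s s' ∧ s'.reg 1 = x ∧
      s'.reg 6 = [c] ∧ s'.reg 4 = if x.length = 1 then x else [] := by
  obtain ⟨b, hb⟩ : ∃ b, x.head? = some b := by
    cases x with
    | nil => exact absurd rfl hx.ne_nil
    | cons b x => exact ⟨b, rfl⟩
  refine (meets_instr_seq (.top _ _) <| meets_forEach (m := 7)
    (I := fun l s' => Keeps s s' ∧ s'.reg 1 = x ∧ s'.reg 6 = [c] ∧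
      (x.length ≠ 1 → s'.reg 4 = []) ∧ (x.length = 1 → b ∉ l → s'.reg 4 = x))
    ?_ _ ⟨?_, ?_, ?_, ?_, ?_⟩).mono ?_ ?_
  · rintro a l s₁ ⟨hk, h1', h6', h4, h4x⟩
    refine (testSymbol_meets h1' h6' hx a).mono le_rfl ?_
    rintro s₂ ⟨hk', h1'', h6'', h4'⟩
    refine ⟨hk.trans hk', h1'', h6'', fun hl => ?_, fun hl hbl => ?_⟩
    · rw [h4', if_neg fun h => hl h.1, h4 hl]
    · rw [h4', hb]
      by_cases hab : b = a
      · rw [if_pos ⟨hl, by rw [hab]⟩]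
      · rw [if_neg fun h => hab (by simpa using h.2), h4x hl (by simp [hab, hbl])]
  · exact (Keeps.refl s).setReg (by omega) (by omega) _
  · simp [Config.setReg, h1]
  · simp [Config.setReg, h6]
  · simp [Config.setReg, topEdge]
  · simp
  · simp
  · rintro s' ⟨hk, h1', h6', h4, h4x⟩
    refine ⟨hk, h1', h6', ?_⟩
    split
    · rename_i h
      exact h4x h (by simp)
    · rename_i h
      exact h4 h

/-- One step of the descent from `⊤` to the edge in register `0` along one-symbol edges. -/
noncomputable def descendRound (σ : Type*) [Fintype σ] : Prog σ :=
  .seq (.instr (.move 6 1)) <|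
  .ite (.eq 6 0) (.instr (.top 4)) (.seq (.instr (.toward 1 6 0)) (testShort σ))

/-- Put the last symbol of the edge in register `0` into register `6`, and, if the edge is longer,
its last two symbols into register `1`. -/
noncomputable def descend (σ : Type*) [Fintype σ] : Prog σ :=
  .seq (.instr (.top 6)) <|
  .seq (.instr (.toward 1 6 0)) <|
  .seq (.instr (.move 4 1)) (.whileNot (.isTop 4) (descendRound σ))

/-- Every further one-symbol edge on the path to `e` raises the depth, which is at most |Σ|. The
first long edge on the path has two symbols, the second of them in register `6`. -/
theorem descend_meets {T : List σ} {s : Config σ} {e : Edge σ} (h0 : s.reg 0 = e)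
    (hi : IsInternal T e) (hne : e ≠ []) :
    (descend σ).Meets T s ((7 * Fintype.card σ + 6) * (Fintype.card σ + 1) + 4) fun s' =>
      Keeps s s' ∧ ∃ c, s'.reg 6 = [c] ∧ [c] <:+ e ∧
        (e ≠ [c] → (s'.reg 1).length = 2 ∧ s'.reg 1 <:+ e) := by
  obtain ⟨x, hx, hxe⟩ := (hi.isAncestor_nil).exists_child hne.symm
  obtain ⟨b, rfl, -, -⟩ := isSuf_nil_iff.1 hx
  refine (meets_instr_seq (.top _ _) <| meets_instr_seq
    (.toward _ _ _ _ [b] (by simpa [Config.setReg, topEdge] using hx)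
      (by simpa [Config.setReg, h0] using hxe)) <| meets_instr_seq (.move _ _ _) <|
    meets_while (m := 7 * Fintype.card σ + 5) (d := Fintype.card σ + 1)
    (I := fun s' d => Keeps s s' ∧ (s'.reg 4 ≠ [] → ∃ c, s'.reg 1 = [c] ∧ IsAncestor T [c] e ∧
        Fintype.card σ - depth T [c] + 1 ≤ d) ∧
      (s'.reg 4 = [] → ∃ c, s'.reg 6 = [c] ∧ [c] <:+ e ∧
        (e ≠ [c] → (s'.reg 1).length = 2 ∧ s'.reg 1 <:+ e))) ?_ ⟨?_, ?_, ?_⟩).mono ?_ ?_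
  · rintro s₁ d ⟨hk, hgo, -⟩ hb
    obtain ⟨c, h1, hce, hd⟩ := hgo hb
    have hk0 : s₁.reg 0 = e := by rw [hk.reg 0 (Or.inl rfl), h0]
    refine (meets_instr_seq (.move _ _ _) <| meets_ite (n := 7 * Fintype.card σ + 3)
      (fun hb => ?_) fun hb => ?_).mono (by omega) fun _ h => h
    · have hec : e = [c] := by
        have : [c] = e := by simpa [Test.Holds, Config.setReg, h1, hk0] using hb
        exact this.symm
      refine (meets_instr (.top _ _) ?_).mono (by omega) fun _ h => h
      refine ⟨0, by omega, (hk.setReg (by omega) (by omega) _).setReg (by omega) (by omega) _, ?_,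
        fun _ => ⟨c, ?_, by rw [hec], fun h => absurd hec h⟩⟩
      · intro h
        exact absurd (by simp [Config.setReg, topEdge]) h
      · simp [Config.setReg, h1]
    · have hec : [c] ≠ e := by
        simpa [Test.Holds, Config.setReg, h1, hk0] using hb
      obtain ⟨x, hx, hxe⟩ := hce.exists_child hec
      refine meets_instr_seq (.toward _ _ _ _ x (by simpa [Config.setReg, h1] using hx)
        (by simpa [Config.setReg, hk0] using hxe)) ?_
      refine (testShort_meets (x := x) (c := c) (by simp [Config.setReg])
        (by simp [Config.setReg, h1]) hx).mono (by omega) ?_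
      rintro s₂ ⟨hk', h1', h6', h4'⟩
      have hk'' := ((hk.setReg (x := 6) (by omega) (by omega) (s₁.reg 1)).setReg (x := 1)
        (by omega) (by omega) x).trans hk'
      rcases hx.child_cases with ⟨a, rfl, -⟩ | ⟨a, rfl, -, -⟩
      · have hlt := depth_lt hx.isAncestor (by
          intro h
          exact hx.not_isAncestor (h ▸ IsAncestor.refl T _))
        have := depth_le T [a]
        refine ⟨Fintype.card σ - depth T [a] + 1, by omega, hk'', fun _ => ⟨a, h1', hxe, le_rfl⟩,
          fun h => ?_⟩
        rw [h4'] at h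
        simp at h
      · have hxe' := hxe.suffix (by simp)
        refine ⟨0, by omega, hk'', fun h => ?_, fun _ => ⟨c, h6', ?_, fun _ => ?_⟩⟩
        · rw [h4'] at h
          simp at h
        · exact (List.suffix_cons a [c]).trans hxe'
        · rw [h1']
          exact ⟨rfl, hxe'⟩
  · exact (((Keeps.refl s).setReg (by omega) (by omega) _).setReg (by omega) (by omega)
      _).setReg (by omega) (by omega) _
  · intro _
    exact ⟨b, by simp [Config.setReg], hxe, by omega⟩
  · intro h
    simp [Config.setReg] at h
  · exact le_of_eq (by ring)
  · rintro s' ⟨hb, d, hk, -, hfin⟩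
    exact ⟨hk, hfin hb⟩

end SufTree

/-! ### Recency of last symbols and the values of one-symbol edges. -/

namespace SufTree

variable {σ : Type*}

/-! ### The history of the updates -/

section History

variable [DecidableEq σ]

/-- The most recent update, up to iteration `i`, of which a string is a suffix. -/
def lastUpdate (u : ℕ → Option (Edge σ)) : ℕ → Edge σ → Edge σ
  | 0 => fun _ => []
  | i + 1 => match u (i + 1) with
    | none => lastUpdate u i
    | some e => reroute (lastUpdate u i) e (e.length + 1)

/-- The last symbols of the updated edges, up to iteration `i`, the most recent one first. -/
def recency (u : ℕ → Option (Edge σ)) : ℕ → List σ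
  | 0 => []
  | i + 1 => match (u (i + 1)).bind List.getLast? with
    | none => recency u i
    | some c => c :: (recency u i).erase c

theorem lastUpdate_eq {u : ℕ → Option (Edge σ)} {i j : ℕ} {g e : Edge σ} (h1 : 1 ≤ j) (hj : j ≤ i)
    (hu : u j = some e) (hg : g <:+ e)
    (hlater : ∀ j', j < j' → j' ≤ i → ∀ e', u j' = some e' → ¬ g <:+ e') :
    lastUpdate u i g = e := by
  induction i with
  | zero => omega
  | succ i ih =>
    rcases hj.eq_or_lt with rfl | hlt
    · simp only [lastUpdate, hu, reroute_full, if_pos hg]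
    · have h := ih (by omega) fun j' hj' hi' => hlater j' hj' (by omega)
      cases hu' : u (i + 1) with
      | none => simpa only [lastUpdate, hu'] using h
      | some e' =>
        simp only [lastUpdate, hu', reroute_full, if_neg (hlater _ hlt le_rfl e' hu')]
        exact h

theorem recency_find? {u : ℕ → Option (Edge σ)} (p : σ → Bool) {i j : ℕ} {c : σ} {e : Edge σ}
    (h1 : 1 ≤ j) (hj : j ≤ i) (hu : u j = some e) (hc : e.getLast? = some c) (hp : p c = true)
    (hlater : ∀ j', j < j' → j' ≤ i → ∀ e', u j' = some e' → ∀ c', e'.getLast? = some c' →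
      p c' = false) :
    (recency u i).find? p = some c := by
  induction i with
  | zero => omega
  | succ i ih =>
    rcases hj.eq_or_lt with rfl | hlt
    · simp [recency, hu, hc, hp]
    · have h := ih (by omega) fun j' hj' hi' => hlater j' hj' (by omega)
      cases hu' : (u (i + 1)).bind List.getLast? with
      | none => simpa only [recency, hu'] using h
      | some c' =>
        obtain ⟨e', he', hc'⟩ := Option.bind_eq_some_iff.1 hu'
        have hpc := hlater _ hlt le_rfl e' he' c' hc'
        simp only [recency, hu', List.find?_cons, hpc]
        rw [← h]
        -- A symbol that fails the test can be erased from any list without changing the result of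
        -- the search.
        generalize recency u i = G
        induction G with
        | nil => rfl
        | cons y G ihG =>
          by_cases hy : y = c'
          · subst hy
            simp [hpc]
          · rw [List.erase_cons_tail (by simpa using hy), List.find?_cons, List.find?_cons, ihG]

end History

/-! ### A list of symbols in registers, ordered by recency -/

/-- What `refresh` leaves unchanged. -/
structure RefreshKeeps (s s' : Config σ) : Prop where
  field : s'.field = s.field
  reg : ∀ j, 10 ≤ j → s'.reg j = s.reg j
  repr : ∀ g, g.length ≠ 1 → s'.repr g = s.repr g

theorem RefreshKeeps.trans {s s' s'' : Config σ} (h : RefreshKeeps s s')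
    (h' : RefreshKeeps s' s'') : RefreshKeeps s s'' :=
  ⟨h'.field.trans h.field, fun j hj => (h'.reg j hj).trans (h.reg j hj),
    fun g hg => (h'.repr g hg).trans (h.repr g hg)⟩

/-- Move the carried edge in register `8` into the `j`-th list register; carry on with its old
contents, unless this is the edge in register `6` or `⊤`. -/
def shiftSlot (j : ℕ) : Prog σ :=
  .ite (.isTop 8) .skip <|
  .seq (.instr (.move 9 (10 + j))) <|
  .seq (.instr (.move (10 + j) 8)) <|
  .ite (.eq 9 6) (.instr (.top 8)) (.instr (.move 8 9))

/-- Move the edge in register `6` to the front of the list in the registers from `10` on. -/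
def toFront (σ : Type*) [Fintype σ] : Prog σ :=
  .seq (.instr (.move 8 6)) (forEach shiftSlot (List.range' 0 (Fintype.card σ)))

variable [DecidableEq σ]

/-- The list `L`, after the carried symbol has been put in front of it. -/
def carryFront (c : σ) (L : List σ) : Option σ → List σ
  | none => L
  | some d => d :: L.erase c

/-- Here `L` is the old content from slot `j` on, and `carry` the symbol still to be placed; it is
`none` once the old copy of `c` or the end of the list has been reached. Empty slots hold ⊤, the
empty string, which makes `Option.toList` the right encoding. -/
theorem shiftSlots_meets {T : List σ} {c : σ} (n j : ℕ) {s : Config σ} {L : List σ}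
    {carry : Option σ} (hL : ∀ i < n, s.reg (10 + (j + i)) = (L[i]?).toList)
    (h8 : s.reg 8 = carry.toList) (h6 : s.reg 6 = [c]) :
    (forEach shiftSlot (List.range' j n)).Meets T s (6 * n + 1) fun s' =>
      s'.repr = s.repr ∧ s'.field = s.field ∧
      (∀ q, q ≤ 7 ∨ 10 ≤ q ∧ q < 10 + j → s'.reg q = s.reg q) ∧
      ∀ i < n, s'.reg (10 + (j + i)) = ((carryFront c L carry)[i]?).toList := by
  induction n generalizing j s L carry with
  | zero => exact (meets_skip ⟨rfl, rfl, fun _ _ => rfl, by simp⟩).mono (by omega) fun _ h => h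
  | succ n ih =>
    rw [List.range'_succ]
    refine (Prog.Meets.seq (m := 6) (R := fun s' => s'.repr = s.repr ∧ s'.field = s.field ∧
      (∀ q, q ≤ 7 ∨ 10 ≤ q ∧ q ≠ 10 + j → s'.reg q = s.reg q) ∧
      ∃ carry', s'.reg 8 = Option.toList carry' ∧ s'.reg (10 + j) =
        ((carryFront c L carry)[0]?).toList ∧
        ∀ i, (carryFront c L carry)[i + 1]? = (carryFront c L.tail carry')[i]?) ?_
      fun s₁ hs₁ => ?_).mono (m := 6 + (6 * n + 1)) (by omega) fun _ h => h
    · cases carry with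
      | none =>
        have hb : (Test.isTop 8).Holds s := h8
        refine (meets_ite (n := 1) (fun _ => meets_skip ⟨rfl, rfl, fun _ _ => rfl, none, h8, ?_,
          ?_⟩) fun hb' => absurd hb hb').mono (by omega) fun _ h => h
        · simpa [carryFront] using hL 0 (by omega)
        · intro i
          simp [carryFront]
      | some d =>
        have hj := hL 0 (by omega)
        rw [Nat.add_zero] at hj
        have e1 : 10 + j ≠ 9 := by omega
        have e2 : 10 + j ≠ 8 := by omega
        have e3 : 10 + j ≠ 6 := by omega
        have hb : ¬ (Test.isTop 8).Holds s := by simp [Test.Holds, h8, topEdge]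
        refine (meets_ite (n := 4) (fun hb' => absurd hb' hb) fun _ =>
          meets_instr_seq (.move _ _ _) <| meets_instr_seq (.move _ _ _) <|
            meets_ite (n := 1) (fun hb => meets_instr (.top _ _) ?_)
              fun hb => meets_instr (.move _ _ _) ?_).mono (by omega) fun _ h => h
        · have hL0 : L[0]? = some c := by
            have : (L[0]?).toList = [c] := by
              simpa [Test.Holds, Config.setReg, e1.symm, e2.symm, e3.symm, hj, h6] using hb
            cases h : L[0]? with
            | none => simp [h] at this
            | some y => simpa [h] using this
          refine ⟨rfl, rfl, ?_, none, by simp [Config.setReg, topEdge], ?_, ?_⟩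
          · intro q hq
            simp only [Config.setReg]
            rw [Function.update_of_ne (by omega), Function.update_of_ne (by omega),
              Function.update_of_ne (by omega)]
          · simp [Config.setReg, e2, h8, carryFront]
          · intro i
            cases L with
            | nil => simp at hL0
            | cons y L =>
              obtain rfl : y = c := by simpa using hL0
              simp [carryFront]
        · have hL0 : L[0]? ≠ some c := by
            intro h
            apply hb
            simp [Test.Holds, Config.setReg, e1.symm, e3.symm, hj, h6, h]
          refine ⟨rfl, rfl, ?_, L[0]?, by simp [Config.setReg, e1.symm, hj], ?_, ?_⟩
          · intro q hq
            simp only [Config.setReg]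
            rw [Function.update_of_ne (by omega), Function.update_of_ne (by omega),
              Function.update_of_ne (by omega)]
          · simp [Config.setReg, e2, h8, carryFront]
          · intro i
            cases L with
            | nil => simp [carryFront]
            | cons y L =>
              have hy : y ≠ c := by simpa using hL0
              simp [carryFront, List.erase_cons_tail, hy]
    · obtain ⟨hr, hf, hreg, carry', h8', hj, hnext⟩ := hs₁
      refine (ih (j + 1) (s := s₁) (L := L.tail) (carry := carry') ?_ h8' ?_).mono le_rfl ?_
      · intro i hi
        have := hL (i + 1) (by omega)
        rw [hreg _ (by omega), show 10 + (j + 1 + i) = 10 + (j + (i + 1)) by omega, this]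
        simp
      · rw [hreg 6 (by omega), h6]
      · rintro s₂ ⟨hr', hf', hreg', hs₂⟩
        refine ⟨hr'.trans hr, hf'.trans hf, fun q hq => ?_, fun i hi => ?_⟩
        · rw [hreg' q (by omega), hreg q (by omega)]
        · cases i with
          | zero => rw [Nat.add_zero, hreg' _ (by omega), hj]
          | succ i =>
            have := hs₂ i (by omega)
            rw [show 10 + (j + (i + 1)) = 10 + (j + 1 + i) by omega, this, hnext]

variable [Fintype σ]

/-- The registers from `10` on contain the list `G`. -/
def HoldsList (G : List σ) (s : Config σ) : Prop :=
  ∀ i < Fintype.card σ, s.reg (10 + i) = (G[i]?).toList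

theorem toFront_meets {T : List σ} {c : σ} {s : Config σ} {G : List σ} (hG : HoldsList G s)
    (h6 : s.reg 6 = [c]) :
    (toFront σ).Meets T s (6 * Fintype.card σ + 2) fun s' =>
      s'.repr = s.repr ∧ s'.field = s.field ∧ HoldsList (c :: G.erase c) s' := by
  refine (meets_instr_seq (.move _ _ _) (shiftSlots_meets (c := c) _ 0 (L := G) (carry := some c)
    ?_ ?_ ?_)).mono le_rfl ?_
  · intro i hi
    simp only [Config.setReg]
    rw [Function.update_of_ne (by omega), Nat.zero_add]
    exact hG i hi
  · simp [Config.setReg, h6]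
  · simp [Config.setReg, h6]
  · rintro s' ⟨hr, hf, -, hs'⟩
    refine ⟨hr, hf, fun i hi => ?_⟩
    have := hs' i hi
    rwa [Nat.zero_add] at this

/-! ### Refreshing the values of the one-symbol edges -/

/-- Enter field `0` of the edge in the `j`-th list register at all its ancestors except `⊤`. -/
def spreadSlot (j : ℕ) : Prog σ :=
  .seq (.instr (.move 8 (10 + j))) <|
  .seq (.instr (.getField 9 0 8)) <|
  .whileNot (.isTop 8) (.seq (.instr (.setRepr 8 9)) (.instr (.suf 8 8)))

/-- Recompute the values of the one-symbol edges from the list, the most recent entry last. -/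
def refresh (σ : Type*) [Fintype σ] : Prog σ :=
  forEach spreadSlot (List.range (Fintype.card σ)).reverse

/-- Ancestors of `[c]` have at most one symbol and decreasing depth, so the climb to ⊤ takes at most
|Σ| rounds. -/
theorem spreadSlot_meets {T : List σ} {s : Config σ} {j : ℕ} {c : σ} (hj : s.reg (10 + j) = [c])
    (hi : IsInternal T [c]) :
    (spreadSlot j).Meets T s (3 * Fintype.card σ + 3) fun s' => RefreshKeeps s s' ∧
      (∀ d, IsAncestor T [d] [c] → s'.repr [d] = s.field 0 [c]) ∧
      ∀ d, ¬ IsAncestor T [d] [c] → s'.repr [d] = s.repr [d] := by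
  refine (meets_instr_seq (.move _ _ _) <| meets_instr_seq (.getField _ _ _ _) <|
    meets_while (m := 2) (d := Fintype.card σ) (I := fun s' d => RefreshKeeps s s' ∧
      s'.reg 9 = s.field 0 [c] ∧ IsAncestor T (s'.reg 8) [c] ∧ depth T (s'.reg 8) ≤ d ∧
      (∀ d, IsAncestor T [d] [c] → ¬ IsAncestor T [d] (s'.reg 8) → s'.repr [d] = s.field 0 [c]) ∧
      ∀ d, ¬ IsAncestor T [d] [c] → s'.repr [d] = s.repr [d]) ?_ ?_).mono (by omega) ?_
  · rintro s₁ d ⟨hk, h9, h8, hd, hset, hkeep⟩ hb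
    obtain ⟨b, hb8⟩ : ∃ b, s₁.reg 8 = [b] := by
      have h1 := h8.length_le
      have h2 : s₁.reg 8 ≠ [] := hb
      have h3 := List.length_pos_iff.2 h2
      exact List.length_eq_one_iff.1 (by simp at h1; omega)
    rw [hb8] at h8 hd hset
    obtain ⟨y, hy⟩ := (h8.isInternal hi).exists_isSuf (by simp)
    refine meets_instr_seq (.setRepr _ _ _) (meets_instr (.suf _ _ _ y (by simpa [hb8] using hy)) ?_)
    have hlt : depth T y < depth T [b] := depth_lt hy.isAncestor (by
      rintro rfl
      exact hy.not_isAncestor (IsAncestor.refl T _))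
    refine ⟨depth T y, by omega, ⟨hk.field, ?_, ?_⟩, ?_, ?_, ?_, ?_, ?_⟩
    · intro q hq
      simp only [Config.setReg]
      rw [Function.update_of_ne (by omega), hk.reg q hq]
    · intro g hg
      simp only [Config.setReg]
      rw [Function.update_of_ne (by rintro rfl; simp [hb8] at hg), hk.repr g hg]
    · simpa [Config.setReg] using h9
    · simpa [Config.setReg] using hy.isAncestor.trans h8
    · simp [Config.setReg]
    · intro d hdc hdy
      simp only [Config.setReg, Function.update_self] at hdy ⊢
      by_cases hdb : d = b
      · subst hdb
        rw [hb8, Function.update_self, h9]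
      · rw [Function.update_of_ne (by simpa [hb8] using hdb)]
        exact hset d hdc fun h => hdy (h.of_isSuf hy (by simpa using hdb))
    · intro d hdc
      simp only [Config.setReg]
      rw [Function.update_of_ne (by rintro h; rw [h, hb8] at hdc; exact hdc h8)]
      exact hkeep d hdc
  · refine ⟨⟨rfl, ?_, fun _ _ => rfl⟩, ?_, ?_, depth_le _ _, ?_, fun _ _ => rfl⟩
    · intro q hq
      simp only [Config.setReg]
      rw [Function.update_of_ne (by omega), Function.update_of_ne (by omega)]
    · simp [Config.setReg, hj]
    · simpa [Config.setReg, hj] using IsAncestor.refl T [c]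
    · intro d hd hd'
      simp [Config.setReg, hj] at hd'
      exact absurd hd hd'
  · rintro s' ⟨hb, d, hk, -, -, -, hset, hkeep⟩
    refine ⟨hk, fun d hd => hset d hd fun h => ?_, hkeep⟩
    have hb' : s'.reg 8 = [] := hb
    rw [hb'] at h
    exact absurd h.eq_nil (by simp)

-- The slots are treated from the last to the first, so a more recent symbol overwrites an older
-- one: after the slots from `n` on, `[d]` carries the value of the first symbol among them that
-- lies below `[d]`.
open Classical in
theorem spreadSlots_meets {T : List σ} {G : List σ} (hi : ∀ c ∈ G, IsInternal T [c]) (n : ℕ)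
    (hn : n ≤ Fintype.card σ) {s : Config σ} (hG : HoldsList G s)
    (hs : ∀ d c, (G.drop n).find? (fun c => IsAncestor T [d] [c]) = some c →
      s.repr [d] = s.field 0 [c]) :
    (forEach spreadSlot (List.range n).reverse).Meets T s ((3 * Fintype.card σ + 3) * n + 1)
      fun s' => RefreshKeeps s s' ∧ ∀ d c, G.find? (fun c => IsAncestor T [d] [c]) = some c →
        s'.repr [d] = s.field 0 [c] := by
  induction n generalizing s with
  | zero =>
    refine (meets_skip ⟨⟨rfl, fun _ _ => rfl, fun _ _ => rfl⟩, ?_⟩).mono (by omega) fun _ h => h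
    simpa using hs
  | succ n ih =>
    rw [List.range_succ, List.reverse_append]
    refine (Prog.Meets.seq (m := 3 * Fintype.card σ + 3) (R := fun s' => RefreshKeeps s s' ∧
      ∀ d c, (G.drop n).find? (fun c => IsAncestor T [d] [c]) = some c →
        s'.repr [d] = s.field 0 [c]) ?_ fun s₁ hs₁ => ?_).mono
      (m := 3 * Fintype.card σ + 3 + ((3 * Fintype.card σ + 3) * n + 1)) (le_of_eq (by ring))
        fun _ h => h
    · have hj := hG n hn
      cases hGn : G[n]? with
      | none =>
        rw [hGn] at hj
        refine (meets_instr_seq (.move _ _ _) <| meets_instr_seq (.getField _ _ _ _) <|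
          meets_while_done ?_ ⟨⟨rfl, ?_, fun _ _ => rfl⟩, ?_⟩).mono (by omega) fun _ h => h
        · simpa [Test.Holds, Config.setReg, topEdge] using hj
        · intro q hq
          simp only [Config.setReg]
          rw [Function.update_of_ne (by omega), Function.update_of_ne (by omega)]
        · intro d c hdc
          rw [List.drop_eq_nil_of_le (by simpa using hGn)] at hdc
          simp at hdc
      | some c =>
        rw [hGn] at hj
        obtain ⟨hlt, hget⟩ := List.getElem?_eq_some_iff.1 hGn
        refine (spreadSlot_meets hj (hi c (hget ▸ List.getElem_mem hlt))).mono le_rfl ?_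
        rintro s' ⟨hk, hset, hkeep⟩
        refine ⟨hk, fun d c' hdc => ?_⟩
        rw [List.drop_eq_getElem_cons hlt, hget, List.find?_cons] at hdc
        by_cases hd : IsAncestor T [d] [c]
        · simp only [hd, decide_true, Option.some.injEq] at hdc
          rw [← hdc]
          exact hset d hd
        · simp only [hd, decide_false] at hdc
          rw [hkeep d hd]
          exact hs d c' hdc
    · obtain ⟨hk, hs₁⟩ := hs₁
      have hG₁ : HoldsList G s₁ := fun i hi => by rw [hk.reg _ (by omega), hG i hi]
      refine (ih (by omega) hG₁ (by rw [hk.field]; exact hs₁)).mono le_rfl ?_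
      rintro s' ⟨hk', hs'⟩
      refine ⟨hk.trans hk', ?_⟩
      rwa [hk.field] at hs'

open Classical in
theorem refresh_meets {T : List σ} {G : List σ} (hi : ∀ c ∈ G, IsInternal T [c]) (hn : G.Nodup)
    {s : Config σ} (hG : HoldsList G s) :
    (refresh σ).Meets T s ((3 * Fintype.card σ + 3) * Fintype.card σ + 1)
      fun s' => RefreshKeeps s s' ∧ ∀ d c, G.find? (fun c => IsAncestor T [d] [c]) = some c →
        s'.repr [d] = s.field 0 [c] := by
  refine spreadSlots_meets hi _ le_rfl hG fun d c h => ?_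
  -- A list without repetitions fits into |Σ| slots, so no entry lies beyond the treated ones.
  rw [List.drop_eq_nil_of_le hn.length_le_card] at h
  simp at h

/-! ### The whole program -/

/-- The work for an updated edge in register `0`. -/
noncomputable def enterUpdate (σ : Type*) [Fintype σ] : Prog σ :=
  .seq (.instr (.top 7)) <|
  .seq (.instr (.setRepr 7 0)) <|
  .seq (descend σ) <|
  .seq (.instr (.setField 0 6 0)) <|
  .seq (.ite (.eq 6 0) .skip (search σ)) (toFront σ)

/-- The program that maintains the values `repr`. -/
noncomputable def maintain (σ : Type*) [Fintype σ] : Prog σ :=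
  .seq (.ite (.isTop 0) .skip (enterUpdate σ)) (refresh σ)

end SufTree

/-! ### Correctness and total time of `maintain`. -/

namespace SufTree

variable {σ : Type*} [Fintype σ]

/-- The invariant of the program, apart from the values at the one-symbol edges: `m` gives the most
recent updates, and `G` the order of their last symbols. -/
structure Maintained (T : List σ) (m : Edge σ → Edge σ) (G : List σ) (s : Config σ) : Prop where
  isLast : IsLast m
  isInternal_last : ∀ g, IsInternal T (m g)
  nodup : G.Nodup
  isInternal_list : ∀ c ∈ G, IsInternal T [c]
  holdsList : HoldsList G s
  field_eq : ∀ c, s.field 0 [c] = m [c]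
  covers : Covers m s.repr
  repr_nil : s.repr [] = m []

theorem Maintained.mono {T T' : List σ} {m : Edge σ → Edge σ} {G : List σ} {s : Config σ}
    (h : Maintained T m G s) (hT : T <:+: T') : Maintained T' m G s :=
  { h with
    isInternal_last := fun g => (h.isInternal_last g).mono hT
    isInternal_list := fun c hc => (h.isInternal_list c hc).mono hT }

variable [DecidableEq σ]

/-- The constant part of the time for an iteration of `maintain`. -/
def baseTime (k : ℕ) : ℕ := (7 * k + 6) * (k + 1) + (6 * k + 2) + ((3 * k + 3) * k + 1) + 80

theorem enterUpdate_exec {T : List σ} {E : Finset (List σ)} (hE : ∀ e, IsInternal T e → e ∈ E)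
    {m : Edge σ → Edge σ} {G : List σ} {s : Config σ} (hs : Maintained T m G s) {e : Edge σ}
    {c : σ} (h0 : s.reg 0 = e) (hi : IsInternal T e) (hc : [c] <:+ e) :
    ∃ s' n, Prog.Exec T (enterUpdate σ) s s' n ∧
      Maintained T (reroute m e (e.length + 1)) (c :: G.erase c) s' ∧
      n + 12 * numUnguided E (reroute m e (e.length + 1)) ≤ 12 * numUnguided E m +
        24 * Nat.log 2 E.card + ((7 * Fintype.card σ + 6) * (Fintype.card σ + 1) +
          (6 * Fintype.card σ + 2) + 70) := by
  have hne : e ≠ [] := by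
    rintro rfl
    simpa using List.suffix_nil.1 hc
  have hc1 : 1 ≤ e.length := hc.length_le
  obtain ⟨s₁, hs₁, hr₁, hf₁, hreg₁⟩ : ∃ s₁, Prog.Exec T (.instr (.setRepr 7 0))
      (s.setReg 7 topEdge) s₁ 1 ∧ s₁.repr = Function.update s.repr [] e ∧ s₁.field = s.field ∧
      ∀ q, q ≠ 7 → s₁.reg q = s.reg q := by
    refine ⟨_, .instr (.setRepr _ _ _), by simp [Config.setReg, h0, topEdge], rfl, fun q hq => ?_⟩
    simp [Config.setReg, Function.update_of_ne hq]
  obtain ⟨s₂, n₂, hs₂, hn₂, hk, c', h6, hc', hlong⟩ := descend_meets (T := T) (s := s₁)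
    (by rw [hreg₁ 0 (by omega), h0]) hi hne
  obtain rfl : c' = c := by
    have := (List.suffix_of_suffix_length_le hc' hc (by simp)).eq_of_length (by simp)
    simpa using this
  have h0₂ : s₂.reg 0 = e := by rw [hk.reg 0 (Or.inl rfl), hreg₁ 0 (by omega), h0]
  obtain ⟨s₃, hs₃, hr₃, hf₃, hreg₃⟩ : ∃ s₃, Prog.Exec T (.instr (.setField 0 6 0)) s₂ s₃ 1 ∧
      s₃.repr = Function.update s.repr [] e ∧
      (∀ d, s₃.field 0 [d] = if d = c' then e else m [d]) ∧ s₃.reg = s₂.reg := by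
    refine ⟨_, .instr (.setField _ _ _ _), by rw [← hr₁, ← hk.repr], fun d => ?_, rfl⟩
    simp only [Function.update_self, h6, h0₂, hk.field, hf₁]
    split
    · rename_i h
      rw [h, Function.update_self]
    · rename_i h
      rw [Function.update_of_ne (by simpa using h), hs.field_eq]
  have hcov₃ : Covers m s₃.repr := hs.covers.congr fun g hg => by
    rw [hr₃, Function.update_of_ne (by rintro rfl; simp at hg)]
  have hfield : ∀ d, s₃.field 0 [d] = reroute m e (e.length + 1) [d] := by
    intro d
    rw [hf₃, reroute_full]
    refine if_congr ⟨?_, fun h => ?_⟩ rfl rfl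
    · rintro rfl; exact hc
    · have := (List.suffix_of_suffix_length_le h hc (by simp)).eq_of_length (by simp)
      simpa using this
  have hpot2 := numUnguided_reroute_two (E := E) m e
  obtain ⟨s₄, n₄, hs₄, hk₄, hcov₄, hn₄⟩ : ∃ s₄ n₄,
      Prog.Exec T (.ite (.eq 6 0) .skip (search σ)) s₃ s₄ n₄ ∧ SearchKeeps s₃ s₄ ∧
      Covers (reroute m e (e.length + 1)) s₄.repr ∧
      n₄ + 12 * numUnguided E (reroute m e (e.length + 1)) ≤ 12 * numUnguided E m +
        24 * Nat.log 2 E.card + 60 := by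
    -- A one-symbol update has no long suffix, so it needs no search.
    by_cases hec : e = [c']
    · refine ⟨s₃, 2, .iteTrue ?_ (.skip _), ⟨rfl, fun _ _ => rfl, fun _ _ => rfl⟩, ?_, ?_⟩
      · show s₃.reg 6 = s₃.reg 0
        rw [hreg₃, h6, h0₂, hec]
      · rw [show e.length + 1 = 2 by simp [hec]]
        exact hcov₃.reroute_two e
      · rw [show e.length + 1 = 2 by simp [hec]]
        omega
    · obtain ⟨ht, hte⟩ := hlong hec
      obtain ⟨s₄, n₄, hs₄, hk₄, hcov₄, hn₄⟩ := search_exec hE hs.isLast hs.isInternal_last hi ht hte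
        hcov₃ (by rw [hreg₃, h0₂]) (by rw [hreg₃])
      refine ⟨s₄, _, .iteFalse ?_ hs₄, hk₄, hcov₄, by omega⟩
      show ¬ s₃.reg 6 = s₃.reg 0
      rw [hreg₃, h6, h0₂]
      exact fun h => hec h.symm
  have hG₄ : HoldsList G s₄ := fun i hi => by
    rw [hk₄.reg _ (by omega), hreg₃, hk.reg _ (by omega), hreg₁ _ (by omega), hs.holdsList i hi]
  obtain ⟨s₅, n₅, hs₅, hn₅, hr₅, hf₅, hG₅⟩ := toFront_meets (T := T) (c := c') hG₄
    (by rw [hk₄.reg 6 (by omega), hreg₃, h6])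
  refine ⟨s₅, _, .seq (.instr (.top _ _)) (.seq hs₁ (.seq hs₂ (.seq hs₃ (.seq hs₄ hs₅)))), ?_, ?_⟩
  · refine ⟨hs.isLast.reroute hne, fun g => ?_, ?_, ?_, hG₅, fun d => ?_, ?_, ?_⟩
    · rw [reroute_full]
      dsimp only
      split
      · exact hi
      · exact hs.isInternal_last g
    · rw [List.nodup_cons]
      exact ⟨fun h => ((List.Nodup.mem_erase_iff hs.nodup).1 h).1 rfl, hs.nodup.erase _⟩
    · intro d hd
      rcases List.mem_cons.1 hd with rfl | hd
      · exact hi.of_suffix hc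
      · exact hs.isInternal_list d (List.mem_of_mem_erase hd)
    · rw [hf₅, hk₄.field, hfield]
    · rw [hr₅]
      exact hcov₄
    · rw [hr₅, hk₄.repr [] (by simp), hr₃, Function.update_self, reroute_pos List.nil_suffix (by simp)]
  · omega

/-- The one-symbol values are refreshed even when nothing is updated, because their parents may have
changed with the text. -/
theorem maintain_exec {T : List σ} {E : Finset (List σ)} (hE : ∀ e, IsInternal T e → e ∈ E)
    {u : ℕ → Option (Edge σ)} {i : ℕ} {s : Config σ}
    (hs : Maintained T (lastUpdate u i) (recency u i) s)
    (hu : ∀ e, u (i + 1) = some e → e ≠ [] ∧ IsInternal T e) :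
    ∃ s' n, Prog.Exec T (maintain σ) (s.setReg 0 ((u (i + 1)).getD topEdge)) s' n ∧
      Maintained T (lastUpdate u (i + 1)) (recency u (i + 1)) s' ∧
      (∀ d c, (open Classical in
        (recency u (i + 1)).find? fun c => IsAncestor T [d] [c]) = some c →
          s'.repr [d] = lastUpdate u (i + 1) [c]) ∧
      n + 12 * numUnguided E (lastUpdate u (i + 1)) ≤ 12 * numUnguided E (lastUpdate u i) +
        24 * Nat.log 2 E.card + baseTime (Fintype.card σ) := by
  have hs' : ∀ e, Maintained T (lastUpdate u i) (recency u i) (s.setReg 0 e) := by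
    intro e
    refine { hs with holdsList := fun j hj => ?_ }
    simp only [Config.setReg]
    rw [Function.update_of_ne (by omega), hs.holdsList j hj]
  obtain ⟨s₁, n₁, hs₁, hm₁, hn₁⟩ : ∃ s₁ n₁, Prog.Exec T (.ite (.isTop 0) .skip (enterUpdate σ))
      (s.setReg 0 ((u (i + 1)).getD topEdge)) s₁ n₁ ∧
      Maintained T (lastUpdate u (i + 1)) (recency u (i + 1)) s₁ ∧
      n₁ + 12 * numUnguided E (lastUpdate u (i + 1)) ≤ 12 * numUnguided E (lastUpdate u i) +
        24 * Nat.log 2 E.card + ((7 * Fintype.card σ + 6) * (Fintype.card σ + 1) +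
          (6 * Fintype.card σ + 2) + 75) := by
    cases hui : u (i + 1) with
    | none =>
      refine ⟨_, 2, .iteTrue ?_ (.skip _), ?_, ?_⟩
      · simp [Test.Holds, Config.setReg]
      · simpa only [lastUpdate, recency, hui, Option.bind_none] using hs' _
      · simp only [lastUpdate, hui]
        omega
    | some e =>
      obtain ⟨hne, hi⟩ := hu e hui
      obtain ⟨c, hc⟩ : ∃ c, e.getLast? = some c := ⟨_, List.getLast?_eq_some_getLast hne⟩
      have hce : [c] <:+ e := by
        obtain ⟨X, rfl⟩ := List.getLast?_eq_some_iff.1 hc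
        exact ⟨X, rfl⟩
      obtain ⟨s₁, n₁, hs₁, hm₁, hn₁⟩ := enterUpdate_exec hE (hs' e) (e := e) (c := c)
        (by simp [Config.setReg]) hi hce
      refine ⟨s₁, _, .iteFalse ?_ hs₁, ?_, ?_⟩
      · simpa [Test.Holds, Config.setReg, topEdge] using hne
      · simpa only [lastUpdate, recency, hui, Option.bind_some, hc] using hm₁
      · simp only [lastUpdate, hui]
        omega
  obtain ⟨s₂, n₂, hs₂, hn₂, hk, hshort⟩ := refresh_meets hm₁.isInternal_list hm₁.nodup hm₁.holdsList
  refine ⟨s₂, _, .seq hs₁ hs₂, { hm₁ with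
    holdsList := fun j hj => by rw [hk.reg _ (by omega), hm₁.holdsList j hj]
    field_eq := fun c => by rw [hk.field, hm₁.field_eq]
    covers := hm₁.covers.congr fun g hg => hk.repr g (by omega)
    repr_nil := by rw [hk.repr [] (by simp), hm₁.repr_nil] }, fun d c hdc => ?_, ?_⟩
  · rw [hshort d c hdc, hm₁.field_eq]
  · unfold baseTime
    omega

/-- The invariant gives the maintained property. -/
theorem Maintained.reprProperty {T : List σ} {u : ℕ → Option (Edge σ)} {i : ℕ} {s : Config σ}
    (hs : Maintained T (lastUpdate u i) (recency u i) s)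
    (hshort : ∀ d c, (open Classical in
      (recency u i).find? fun c => IsAncestor T [d] [c]) = some c →
        s.repr [d] = lastUpdate u i [c])
    (hu : ∀ j, 1 ≤ j → j ≤ i → ∀ e, u j = some e → e ≠ [] ∧ IsInternal T e) :
    ReprProperty T u i s.repr := by
  classical
  rintro g e hg ⟨hge, j, h1, hj, huj, hlater⟩
  obtain ⟨hne, hi⟩ := hu j h1 hj e huj
  match g, hg, hge, hlater with
  | [], _, _, hlater =>
    refine ⟨[], IsAncestor.refl T [], ?_⟩
    rw [hs.repr_nil]
    refine lastUpdate_eq h1 hj huj List.nil_suffix fun j' hj' hi' e' he' _ => ?_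
    exact hlater j' hj' hi' e' he' (hu j' (by omega) hi' e' he').2.isAncestor_nil
  | [d], _, hge, hlater =>
    refine ⟨[d], IsAncestor.refl T [d], ?_⟩
    obtain ⟨c, hc⟩ : ∃ c, e.getLast? = some c := ⟨_, List.getLast?_eq_some_getLast hne⟩
    have hsuf : ∀ {e : Edge σ} {c : σ}, e.getLast? = some c → [c] <:+ e := by
      intro e c hc
      obtain ⟨X, rfl⟩ := List.getLast?_eq_some_iff.1 hc
      exact ⟨X, rfl⟩
    -- The way up from `e` to a one-symbol edge passes through the last symbol of `e`. Whether an
    -- update lies below `[d]` is thus decided by its last symbol, and the recency list suffices.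
    have hdc : IsAncestor T [d] [c] := hge.of_suffix hi (by simp) (hsuf hc) (by simp)
    have hno : ∀ j', j < j' → j' ≤ i → ∀ e', u j' = some e' → ∀ c', [c'] <:+ e' →
        ¬ IsAncestor T [d] [c'] := by
      intro j' hj' hi' e' he' c' hc' hdc'
      have hi'' := (hu j' (by omega) hi' e' he').2
      exact hlater j' hj' hi' e' he' (hdc'.trans (hi''.isAncestor_of_suffix hc' (by simp)))
    rw [hshort d c]
    · exact lastUpdate_eq h1 hj huj (hsuf hc) fun j' hj' hi' e' he' hce =>
        hno j' hj' hi' e' he' c hce hdc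
    · exact recency_find? _ h1 hj huj hc (by simpa using hdc) fun j' hj' hi' e' he' c' hc' => by
        simpa using hno j' hj' hi' e' he' c' (hsuf hc')
  | a :: b :: g, hg, hge, hlater =>
    have hl : 2 ≤ (a :: b :: g).length := by simp
    obtain ⟨x, hx, hxl, hρ⟩ := hs.covers.exists_suffix hl
    refine ⟨x, (hg.isAncestor_iff hxl).2 hx, ?_⟩
    rw [hρ]
    refine lastUpdate_eq h1 hj huj (hge.suffix hl) fun j' hj' hi' e' he' h => ?_
    exact hlater j' hj' hi' e' he' (((hu j' (by omega) hi' e' he').2.isAncestor_iff hl).2 h)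

theorem maintain_correct (σ : Type*) [Fintype σ] [DecidableEq σ] :
    ∃ C : ℝ, ∀ (T : List σ) (u : ℕ → Option (Edge σ)), IsSchedule T u →
      ∃ (S : ℕ → Config σ) (n : ℕ → ℕ), IsRun (maintain σ) T u S n ∧
        (∀ i ≤ T.length, ReprProperty (T.take i) u i (S i).repr) ∧
        (2 ≤ T.length → ((∑ i ∈ Finset.range T.length, n i : ℕ) : ℝ) ≤
          C * (T.length * Real.log T.length)) := by
  classical
  -- The first 24 absorbs the initial potential, at most 12 (N + 1) ≤ 24 N; the second is the
  -- coefficient of the logarithm, doubled by the passage from |E| to N.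
  refine ⟨(24 + baseTime (Fintype.card σ) + 2 * 24) / Real.log 2, fun T u hu => ?_⟩
  have hup : ∀ j, 1 ≤ j → j ≤ T.length → ∀ i, j ≤ i → ∀ e, u j = some e →
      e ≠ [] ∧ IsInternal (T.take i) e := by
    intro j h1 hj i hi e he
    obtain ⟨hne, V, hV, -⟩ := hu j h1 hj e he
    exact ⟨hne, hV.isInternal.mono (List.take_prefix_take_left hi).isInfix⟩
  obtain ⟨S, n, hrun, hinv, hn⟩ := exists_isRun (P := maintain σ) (T := T) (u := u)
    (fun i s => Maintained (T.take i) (lastUpdate u i) (recency u i) s ∧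
      ∀ d c, (recency u i).find? (fun c => IsAncestor (T.take i) [d] [c]) = some c →
        s.repr [d] = lastUpdate u i [c])
    (fun i _ => 12 * (numUnguided (edges T) (lastUpdate u i) : ℝ))
    (24 * Real.logb 2 (edges T).card + baseTime (Fintype.card σ))
    ⟨⟨⟨fun g h => absurd rfl h, fun _ _ _ _ => rfl, fun _ _ _ _ => rfl⟩,
      fun g => isInternal_nil _, List.nodup_nil, by simp [recency],
      fun i _ => by simp [recency, Config.init, topEdge],
      fun _ => rfl, ⟨fun _ _ => rfl, fun _ _ => Or.inl rfl, fun _ _ _ => rfl⟩, rfl⟩,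
      by simp [recency]⟩
    (fun _ _ => by positivity)
    (fun i hi s hs => by
      obtain ⟨s', k, hex, hm, hshort, hk⟩ := maintain_exec (T := T.take (i + 1)) (E := edges T)
        (fun e he => mem_edges.2 (he.mono (List.take_prefix _ _).isInfix))
        (hs.1.mono (List.take_prefix_take_left (by omega)).isInfix)
        (hup (i + 1) (by omega) hi (i + 1) le_rfl)
      refine ⟨s', k, hex, ⟨hm, hshort⟩, ?_⟩
      have hk' : (k : ℝ) + 12 * numUnguided (edges T) (lastUpdate u (i + 1)) ≤
          12 * numUnguided (edges T) (lastUpdate u i) + 24 * Nat.log 2 (edges T).card +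
            baseTime (Fintype.card σ) := by exact_mod_cast hk
      have hlog := Real.natLog_le_logb (edges T).card 2
      push_cast at hlog
      linarith)
  refine ⟨S, n, hrun, fun i hi => ?_, fun hT => ?_⟩
  · exact (hinv i hi).1.reprProperty (hinv i hi).2
      fun j h1 hj e he => hup j h1 (hj.trans hi) i hj e he
  · have h0 : (numUnguided (edges T) (lastUpdate u 0) : ℝ) ≤ T.length + 1 := by
      exact_mod_cast (Finset.card_filter_le _ _).trans (card_edges_le T)
    have hN : (2 : ℝ) ≤ T.length := by exact_mod_cast hT
    have h1 := mul_logb_card_edges_le hT (24 + baseTime (Fintype.card σ)) 24 (by positivity)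
      (by norm_num)
    refine le_trans ?_ h1
    linarith

end SufTree

theorem lemma5 (σ : Type*) [Fintype σ] [DecidableEq σ] :
    (∃ (P : SufTree.Prog σ) (C : ℝ), ∀ (T : List σ) (u : ℕ → Option (SufTree.Edge σ)),
      SufTree.IsSchedule T u →
      ∃ (S : ℕ → SufTree.Config σ) (n : ℕ → ℕ),
        SufTree.IsRun P T u S n ∧
        (∀ i ≤ T.length, SufTree.ReprProperty (T.take i) u i (S i).repr) ∧
        (2 ≤ T.length →
          ((∑ i ∈ Finset.range T.length, n i : ℕ) : ℝ) ≤
            C * (T.length * Real.log T.length))) ∧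
    (∃ C : ℝ, ∀ (T : List σ) (u : ℕ → Option (SufTree.Edge σ)),
      SufTree.IsSchedule T u →
      ∃ (S : ℕ → SufTree.Config σ) (n : ℕ → ℕ),
        SufTree.IsRun (SufTree.reprupd σ) T u S n ∧
        (2 ≤ T.length →
          ((∑ i ∈ Finset.range T.length, n i : ℕ) : ℝ) ≤
            C * (T.length * Real.log T.length))) :=
  ⟨⟨SufTree.maintain σ, SufTree.maintain_correct σ⟩, SufTree.reprupd_total_time σ⟩
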